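/- Let $m\ge 1$ be an integer and $0<a<1$. There is a unique real polynomial $P_m$ of degree at most $2m$ that best approximates $|x|$ uniformly on $[-1,-a]\cup[a,1]$; let $$L=\min_{\deg P\le 2m}\ \max_{a\le |x|\le 1}\bigl||x|-P(x)\bigr|$$ be the approximation error. Then there is a simple curve $\gamma:(0,\infty)\to\mathbb C$ inside the half-strip $$S=\{u+iv:\ 0<u<(m+1)\pi,\ v>0\},$$ starting at a point $iv_0$, $v_0>0$, of its left side (that is, $\gamma(y)\to iv_0$ as $y\to 0^+$) and running to infinity (that is, $\operatorname{Im}\gamma(y)\to+\infty$ as $y\to+\infty$), such that $$P_m(z)=z+L\cos\phi_m(z)\qquad(\operatorname{Re}z\ge0,\ \operatorname{Im}z\ge0),$$ where $\phi_m$ is a conformal map of the open first quadrant onto the region $G\subset S$ bounded on the left by $\gamma$, i.e. the connected component $G$ of $S\setminus\gamma((0,\infty))$ whose boundary consists of $\gamma((0,\infty))$, the segment $[0,iv_0]$, the segment $[0,(m+1)\pi]$ and the ray $\{(m+1)\pi+iv:\ v\ge 0\}$. The map $\phi_m$ extends continuously to the closed first quadrant and is normalized by $\phi_m(a)=0$,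 $\phi_m(1)=(m+1)\pi$ and $\phi_m(z)\to\infty$ as $z\to\infty$. Moreover, $\gamma$ is the image of the positive imaginary half-axis, $\gamma(y)=\phi_m(iy)=u(y)+iv(y)$ for $y>0$, and satisfies the functional equation $$L\sin u(y)\,\sinh v(y)=y\qquad\text{for all } y>0.$$ -/

import Mathlib

open Set Filter Topology Polynomial

noncomputable section

/-- The set `[-1, -a] ∪ [a, 1]`. -/
def twoIntervals (a : ℝ) : Set ℝ := Icc (-1) (-a) ∪ Icc a 1

/-- The uniform deviation of `P` from `|x|` on `[-1, -a] ∪ [a, 1]`. -/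
def deviation (a : ℝ) (P : ℝ[X]) : ℝ :=
  sSup ((fun x : ℝ => |(|x|) - P.eval x|) '' twoIntervals a)

/-- The error `L_m(a)` of the best uniform approximation of `|x|` on `[-1, -a] ∪ [a, 1]`
by polynomials of degree at most `2m`. -/
def approxError (m : ℕ) (a : ℝ) : ℝ :=
  sInf (deviation a '' {P : ℝ[X] | P.natDegree ≤ 2 * m})

/-- `P` is a best uniform approximation of `|x|` by polynomials of degree at most `2m`. -/
def IsBestApprox (m : ℕ) (a : ℝ) (P : ℝ[X]) : Prop :=
  P.natDegree ≤ 2 * m ∧ deviation a P = approxError m a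

/-- The open first quadrant. -/
def openQuadrant : Set ℂ := {z | 0 < z.re ∧ 0 < z.im}

/-- The closed first quadrant. -/
def closedQuadrant : Set ℂ := {z | 0 ≤ z.re ∧ 0 ≤ z.im}

/-- The open half-strip `0 < u < W`, `v > 0`. -/
def halfStrip (W : ℝ) : Set ℂ := {w | 0 < w.re ∧ w.re < W ∧ 0 < w.im}

/-- `γ : (0, ∞) → ℂ` is a simple curve inside the half-strip of width `W` that starts at the
point `i v₀` of its left side and runs to infinity. -/
structure IsCrosscut (W : ℝ) (γ : ℝ → ℂ) (v₀ : ℝ) : Prop where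
  continuousOn : ContinuousOn γ (Ioi 0)
  injOn : InjOn γ (Ioi 0)
  mapsTo : MapsTo γ (Ioi 0) (halfStrip W)
  start_pos : 0 < v₀
  tendsto_start : Tendsto γ (𝓝[>] 0) (𝓝 ((v₀ : ℂ) * Complex.I))
  tendsto_end : Tendsto (fun y => (γ y).im) atTop atTop

/-- `G` is the region in the half-strip of width `W` bounded on the left by the curve `γ` (which
starts at `i v₀`): it is the connected component of the half-strip cut along `γ` whose boundary
consists of `γ`, the part `[0, i v₀]` of the left side below `γ`, the whole bottom side `[0, W]`,
and the whole right side. -/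
structure IsRegionBoundedOnLeft (W : ℝ) (γ : ℝ → ℂ) (v₀ : ℝ) (G : Set ℂ) : Prop where
  component : ∃ w ∈ halfStrip W \ γ '' Ioi 0,
    G = connectedComponentIn (halfStrip W \ γ '' Ioi 0) w
  frontier_eq : frontier G =
    γ '' Ioi 0 ∪ (fun t : ℝ => (t : ℂ) * Complex.I) '' Icc 0 v₀
      ∪ (fun t : ℝ => (t : ℂ)) '' Icc 0 W
      ∪ (fun t : ℝ => (W : ℂ) + (t : ℂ) * Complex.I) '' Ici 0

/-- `φ` maps the open first quadrant conformally onto `G`, extends continuously to the closed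
first quadrant, and satisfies `φ(a) = 0`, `φ(1) = W`, `φ(∞) = ∞`. -/
structure IsNormalizedConformalMap (a W : ℝ) (φ : ℂ → ℂ) (G : Set ℂ) : Prop where
  differentiableOn : DifferentiableOn ℂ φ openQuadrant
  injOn : InjOn φ openQuadrant
  image_eq : φ '' openQuadrant = G
  continuousOn : ContinuousOn φ closedQuadrant
  map_a : φ (a : ℂ) = 0
  map_one : φ 1 = (W : ℂ)
  map_infty : Tendsto φ (Bornology.cobounded ℂ ⊓ 𝓟 closedQuadrant) (Bornology.cobounded ℂ)

end

/-!
The even part of a best approximation is again one, so consider the error `E x = Q(x²) - x` of an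
optimal even polynomial, with maximum `L` on `[a, 1]`. At the positive critical points `x` of `E`
the polynomial `Q'` interpolates `1 / (2 √t)` at `t = x²`, so by Rolle's theorem there are at most
`m` of them; optimality requires at least `m + 2` extremal points in `[a, 1]`. Hence `E`
equioscillates at `a`, at `1` and at its `m` critical points, which gives uniqueness.

For `|w| < L` write `E - w = p S`, where the roots of `p` are the `m + 1` roots of `E - w` in
`(a, 1)`. Then `S(z) / p(-z)` is real on the real axis, and on the positive imaginary axis its
imaginary part is negative, as that of `E` is. By Phragmén–Lindelöf it is negative throughout the
open quadrant, so `E` omits `w` there. Therefore `φ = arccos (E / L)` has a branch with `0 < Im φ`.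
On the real axis `Re φ` vanishes up to `a`, increases by `π` between consecutive nodes, and is
`(m + 1) π` from `1` on. On the imaginary axis `Im E = -y` becomes the functional equation, and `u`
is strictly increasing since `Re E = Q(-y²)` is decreasing and concave there.

As `φ` grows at most linearly, Phragmén–Lindelöf carries inequalities between real parts from the
axes to the quadrant. Applied to `φ` and `(m + 1) π - φ` it puts the image in the half-strip;
applied to `φ(c z) - φ(z)` with `c > 1` it gives `0 < Re (z φ'(z))`, so `φ` is univalent by the
Noshiro–Warschawski argument in the coordinate `log z`. Finally `φ` tends to infinity, so the
boundary of the image is the image of the two half-axes, which identifies the image as a component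
of the slit half-strip.
-/

lemma aeval_complex_ofReal (S : ℝ[X]) (t : ℝ) : aeval (t : ℂ) S = ((S.eval t : ℝ) : ℂ) :=
  Polynomial.aeval_ofReal S t

/-- The error `Q(x²) - x` of the even polynomial `Q(x²)` as an approximation of `x`. On the positive
axis it is the error of approximating `|x|`. -/
noncomputable def evenError (Q : ℝ[X]) : ℝ[X] := Q.comp (X ^ 2) - X

section EvenError

variable (Q : ℝ[X])

lemma eval_evenError (t : ℝ) : (evenError Q).eval t = Q.eval (t ^ 2) - t := by
  simp [evenError]

lemma eval_derivative_evenError (t : ℝ) :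
    (derivative (evenError Q)).eval t = 2 * t * (derivative Q).eval (t ^ 2) - 1 := by
  norm_num [evenError, derivative_comp]

lemma aeval_evenError (z : ℂ) : aeval z (evenError Q) = aeval (z ^ 2) Q - z := by
  simp [evenError, aeval_comp]

lemma aeval_evenError_mul_I (y : ℝ) :
    aeval (y * Complex.I) (evenError Q) = (Q.eval (-y ^ 2) : ℝ) - y * Complex.I := by
  have hsq : ((y : ℂ) * Complex.I) ^ 2 = ((-y ^ 2 : ℝ) : ℂ) := by
    rw [mul_pow, Complex.I_sq]; push_cast; ring
  rw [aeval_evenError, hsq, aeval_complex_ofReal]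

lemma natDegree_evenError_le : (evenError Q).natDegree ≤ max (2 * Q.natDegree) 1 := by
  refine (natDegree_sub_le _ _).trans (max_le_max ?_ natDegree_X_le)
  rw [natDegree_comp, natDegree_X_pow, mul_comm]

/-- `Q(x²)` is even while `x` is not. -/
lemma evenError_ne_C (c : ℝ) : evenError Q ≠ C c := by
  intro h
  have h₁ := congrArg (eval 1) h
  have h₂ := congrArg (eval (-1)) h
  rw [eval_evenError, eval_C] at h₁ h₂
  norm_num at h₁ h₂
  linarith

lemma degree_evenError_pos : 0 < (evenError Q).degree :=
  lt_of_not_ge fun hle => evenError_ne_C Q _ (eq_C_of_degree_le_zero hle)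

end EvenError

/-! ### Polynomials interpolating a negative power -/

lemma exists_strictMono_deriv_eq_zero {f f' : ℝ → ℝ} {n : ℕ} {z : Fin (n + 1) → ℝ}
    (hz : StrictMono z) (hf : ∀ t, z 0 ≤ t → HasDerivAt f (f' t) t) (hzero : ∀ i, f (z i) = 0) :
    ∃ z' : Fin n → ℝ, StrictMono z' ∧ ∀ i, z i.castSucc < z' i ∧ f' (z' i) = 0 := by
  have rolle : ∀ i : Fin n, ∃ c ∈ Ioo (z i.castSucc) (z i.succ), f' c = 0 := fun i => by
    have hle : z 0 ≤ z i.castSucc := hz.monotone (Fin.zero_le _)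
    exact exists_hasDerivAt_eq_zero (hz (Fin.castSucc_lt_succ))
      (fun t ht => (hf t (hle.trans ht.1)).continuousAt.continuousWithinAt)
      ((hzero _).trans (hzero _).symm) fun t ht => hf t (hle.trans ht.1.le)
  choose z' hz' hzero' using rolle
  refine ⟨z', fun i j hij => ?_, fun i => ⟨(hz' i).1, hzero' i⟩⟩
  calc z' i < z i.succ := (hz' i).2
    _ ≤ z j.castSucc := hz.monotone (by simpa [Fin.le_def] using hij)
    _ < z' j := (hz' j).1

lemma exists_strictMono_derivative_eval_eq_rpow {Q : ℝ[X]} {c α : ℝ} {n : ℕ}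
    {z : Fin (n + 1) → ℝ} (hz : StrictMono z) (hz₀ : 0 < z 0)
    (hQz : ∀ i, Q.eval (z i) = c * z i ^ α) :
    ∃ z' : Fin n → ℝ, StrictMono z' ∧
      ∀ i, z i.castSucc < z' i ∧ (derivative Q).eval (z' i) = c * α * z' i ^ (α - 1) := by
  have hderiv : ∀ t, z 0 ≤ t → HasDerivAt (fun t => Q.eval t - c * t ^ α)
      ((derivative Q).eval t - c * (α * t ^ (α - 1))) t := fun t ht =>
    (Q.hasDerivAt t).sub
      ((Real.hasDerivAt_rpow_const (Or.inl (hz₀.trans_le ht).ne')).const_mul c)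
  obtain ⟨z', hz', h⟩ :=
    exists_strictMono_deriv_eq_zero hz hderiv fun i => sub_eq_zero.2 (hQz i)
  exact ⟨z', hz', fun i => ⟨(h i).1, by linarith [(h i).2]⟩⟩

/-- A polynomial interpolating `c t ^ α` inherits from it the alternating signs of its derivatives:
the functions `c t ^ α` with `0 < c` and `α < 0` are stable under `-d/dt`, and Rolle's theorem
preserves the interpolation. -/
lemma neg_one_pow_mul_iterate_derivative_pos_of_eval_eq_rpow {n : ℕ} {Q : ℝ[X]} {c α : ℝ}
    {z : Fin (n + 1) → ℝ} (hQ : Q.natDegree ≤ n) (hc : 0 < c) (hα : α < 0) (hz : StrictMono z)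
    (hz₀ : 0 < z 0) (hQz : ∀ i, Q.eval (z i) = c * z i ^ α) {k : ℕ} (hk : k ≤ n) {t : ℝ}
    (ht : t ≤ z 0) : 0 < (-1) ^ k * (derivative^[k] Q).eval t := by
  induction n generalizing Q c α k t with
  | zero =>
    obtain rfl : k = 0 := by lia
    have hz_pos : 0 < c * z 0 ^ α := by positivity
    rw [eq_C_of_natDegree_le_zero hQ] at hQz ⊢
    simpa [← hQz 0] using hz_pos
  | succ n ih =>
    obtain ⟨z', hz', hQz'⟩ := exists_strictMono_derivative_eval_eq_rpow hz hz₀ hQz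
    have hlt : z 0 < z' 0 := (hQz' 0).1
    have ih' : ∀ k ≤ n, ∀ t ≤ z' 0, 0 < (-1) ^ k * (derivative^[k] (-derivative Q)).eval t :=
      fun k hk t ht => ih (c := c * -α) (α := α - 1)
        ((natDegree_neg _).le.trans ((natDegree_derivative_le Q).trans (by lia)))
        (mul_pos hc (neg_pos.2 hα)) (by linarith) hz' (hz₀.trans hlt)
        (fun i => by rw [eval_neg, (hQz' i).2]; ring) hk ht
    cases k with
    | succ k =>
      have := ih' k (by lia) t (ht.trans hlt.le)
      rwa [iterate_derivative_neg, eval_neg, mul_neg, ← neg_mul, ← mul_neg_one, ← pow_succ,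
        ← Function.iterate_succ_apply] at this
    | zero =>
      have hanti : AntitoneOn Q.eval (Iic (z' 0)) :=
        antitoneOn_of_deriv_nonpos (convex_Iic _) Q.continuous.continuousOn
          Q.differentiable.differentiableOn fun t ht => by
            have := ih' 0 n.zero_le t (interior_subset (s := Iic (z' 0)) ht)
            simp only [Function.iterate_zero, id_eq, pow_zero, one_mul, eval_neg] at this
            rw [Polynomial.deriv]
            linarith
      have hz_pos : 0 < c * z 0 ^ α := by positivity
      have := hanti (ht.trans hlt.le) hlt.le ht
      simp only [Function.iterate_zero, id_eq, pow_zero, one_mul]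
      linarith [hQz 0]

lemma card_le_natDegree_add_one_of_eval_eq_rpow {Q : ℝ[X]} {c α : ℝ} (hc : 0 < c) (hα : α < 0)
    {s : Finset ℝ} (hs : ∀ t ∈ s, 0 < t ∧ Q.eval t = c * t ^ α) : s.card ≤ Q.natDegree + 1 := by
  by_contra! hcard
  obtain ⟨s', hs', hcard'⟩ := Finset.exists_subset_card_eq (Nat.succ_le_of_lt hcard)
  have hmem (i) : s'.orderEmbOfFin hcard' i ∈ s := hs' (Finset.orderEmbOfFin_mem s' hcard' i)
  have := neg_one_pow_mul_iterate_derivative_pos_of_eval_eq_rpow (Nat.le_succ _) hc hα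
    (s'.orderEmbOfFin hcard').strictMono (hs _ (hmem _)).1 (fun i => (hs _ (hmem i)).2) le_rfl
    le_rfl
  rw [iterate_derivative_eq_zero (Nat.lt_succ_self _)] at this
  simp at this

/-! ### Critical points of the error -/

lemma half_mul_sq_rpow_neg_half {t : ℝ} (ht : 0 < t) :
    (1 / 2 : ℝ) * (t ^ 2) ^ (-(1 / 2) : ℝ) = 1 / (2 * t) := by
  rw [Real.rpow_neg (sq_nonneg t), ← Real.sqrt_eq_rpow, Real.sqrt_sq ht.le]
  ring

lemma eval_derivative_evenError_eq_zero_iff {Q : ℝ[X]} {t : ℝ} (ht : 0 < t) :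
    (derivative (evenError Q)).eval t = 0 ↔
      (derivative Q).eval (t ^ 2) = (1 / 2 : ℝ) * (t ^ 2) ^ (-(1 / 2) : ℝ) := by
  rw [half_mul_sq_rpow_neg_half ht, eval_derivative_evenError, sub_eq_zero,
    eq_div_iff (by positivity), mul_comm]

/-- The positive critical points of the error `Q(x²) - x`. -/
noncomputable def criticalPoints (Q : ℝ[X]) : Finset ℝ :=
  {t ∈ (derivative (evenError Q)).roots.toFinset | 0 < t}

lemma mem_criticalPoints {Q : ℝ[X]} {t : ℝ} :
    t ∈ criticalPoints Q ↔ 0 < t ∧ (derivative (evenError Q)).eval t = 0 := by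
  have hne : derivative (evenError Q) ≠ 0 := fun h => by
    simpa [eval_derivative_evenError] using congrArg (eval 0) h
  simp [criticalPoints, hne, and_comm]

lemma card_criticalPoints_le {m : ℕ} (hm : 1 ≤ m) {Q : ℝ[X]} (hQ : Q.natDegree ≤ m) :
    (criticalPoints Q).card ≤ m := by
  have hinj : InjOn (fun t : ℝ => t ^ 2) (criticalPoints Q) := fun s hs t ht h =>
    (sq_eq_sq₀ (mem_criticalPoints.1 hs).1.le (mem_criticalPoints.1 ht).1.le).1 h
  rw [← Finset.card_image_of_injOn hinj]
  refine (card_le_natDegree_add_one_of_eval_eq_rpow (Q := derivative Q) (c := 1 / 2)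
    (α := -(1 / 2)) (by norm_num) (by norm_num) fun u hu => ?_).trans ?_
  · obtain ⟨t, ht, rfl⟩ := Finset.mem_image.1 hu
    obtain ⟨ht₀, ht'⟩ := mem_criticalPoints.1 ht
    exact ⟨by positivity, (eval_derivative_evenError_eq_zero_iff ht₀).1 ht'⟩
  · have := natDegree_derivative_le Q
    lia

/-! ### Best approximation and equioscillation -/

lemma exists_forall_norm_sub_le {E : Type*} [NormedAddCommGroup E] [NormedSpace ℝ E]
    (V : Submodule ℝ E) [FiniteDimensional ℝ V] (f : E) :
    ∃ v ∈ V, ∀ w ∈ V, ‖v - f‖ ≤ ‖w - f‖ := by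
  have : ProperSpace V := FiniteDimensional.proper ℝ V
  have hcont : Continuous fun v : V => ‖(v : E) - f‖ := by fun_prop
  have hcoercive : Tendsto (fun v : V => ‖(v : E) - f‖) (cocompact V) atTop :=
    tendsto_atTop_mono (fun v : V => norm_sub_norm_le (v : E) f)
      (tendsto_atTop_add_const_right _ _ (tendsto_norm_cocompact_atTop (E := V)))
  obtain ⟨v, hv⟩ := hcont.exists_forall_le hcoercive
  exact ⟨v, v.2, fun w hw => hv ⟨w, hw⟩⟩

lemma degree_lt_add_one_iff_natDegree_le {R : Type*} [Semiring R] {p : R[X]} {n : ℕ} :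
    p.degree < (n + 1 : ℕ) ↔ p.natDegree ≤ n := by
  simp only [degree_lt_iff_coeff_zero, natDegree_le_iff_coeff_eq_zero, Nat.succ_le_iff]

/-- `Q(x²)` is a best uniform approximation of `x` on `[a, 1]`, with error `L`, among the even
polynomials of degree at most `2 m`. -/
structure IsBestEvenApprox (m : ℕ) (a L : ℝ) (Q : ℝ[X]) : Prop where
  natDegree_le : Q.natDegree ≤ m
  abs_le : ∀ t ∈ Icc a 1, |(evenError Q).eval t| ≤ L
  exists_le : ∀ R : ℝ[X], R.natDegree ≤ m → ∃ t ∈ Icc a 1, L ≤ |(evenError R).eval t|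

lemma exists_isBestEvenApprox (m : ℕ) {a : ℝ} (ha : a < 1) :
    ∃ L Q, 0 < L ∧ IsBestEvenApprox m a L Q := by
  let restrict : ℝ[X] →ₐ[ℝ] C(Icc a 1, ℝ) := toContinuousMapOnAlgHom (Icc a 1)
  let T : ℝ[X] →ₗ[ℝ] C(Icc a 1, ℝ) := (restrict.comp (aeval (X ^ 2))).toLinearMap
  have : FiniteDimensional ℝ (degreeLT ℝ (m + 1)) :=
    Module.Finite.equiv (degreeLTEquiv ℝ (m + 1)).symm
  obtain ⟨_, ⟨Q, hQ, rfl⟩, hbest⟩ :=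
    exists_forall_norm_sub_le ((degreeLT ℝ (m + 1)).map T) (restrict X)
  have hval : ∀ (R : ℝ[X]) (t : Icc a 1), (T R - restrict X) t = (evenError R).eval (t : ℝ) := by
    intro R t
    simp [T, restrict, evenError, comp, aeval_def, algebraMap_eq]
  have hpos : 0 < ‖T Q - restrict X‖ := norm_pos_iff.2 fun h =>
    evenError_ne_C Q 0 <| by
      rw [C_0]
      exact eq_zero_of_infinite_isRoot _ <| (Icc_infinite ha).mono fun t ht => by
        rw [mem_ofPred_eq, IsRoot, ← hval Q ⟨t, ht⟩, h, ContinuousMap.zero_apply]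
  refine ⟨_, Q, hpos, degree_lt_add_one_iff_natDegree_le.1 (mem_degreeLT.1 hQ), fun t ht => ?_,
    fun R hR => ?_⟩
  · rw [← hval Q ⟨t, ht⟩]
    exact (T Q - restrict X).norm_coe_le_norm ⟨t, ht⟩
  · by_contra! h
    refine (hbest (T R) ⟨R, mem_degreeLT.2 (degree_lt_add_one_iff_natDegree_le.2 hR), rfl⟩).not_gt
      ((ContinuousMap.norm_lt_iff _ hpos).2 fun t => ?_)
    rw [hval]
    exact h t t.2

lemma exists_perturbation_lt {X : Type*} [TopologicalSpace X] {K : Set X} (hK : IsCompact K)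
    {r q : X → ℝ} (hr : Continuous r) (hq : Continuous q) {L : ℝ} (hL : 0 < L)
    (hle : ∀ x ∈ K, |r x| ≤ L) (hsign : ∀ x ∈ K, |r x| = L → 0 < r x * q x) :
    ∃ ε : ℝ, ∀ x ∈ K, |r x - ε * q x| < L := by
  have key : ∀ᶠ ε in 𝓝 (0 : ℝ), ∀ x ∈ K, x ∈ K → 0 < ε → |r x - ε * q x| < L := by
    refine hK.eventually_forall_of_forall_eventually
      (P := fun ε x => x ∈ K → 0 < ε → |r x - ε * q x| < L) fun x hx => ?_
    rcases (hle x hx).lt_or_eq with hlt | heq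
    · have hc : ContinuousAt (fun z : ℝ × X => |r z.2 - z.1 * q z.2|) (0, x) := by fun_prop
      filter_upwards [hc.eventually_lt_const (by simpa using hlt)] with z hz _ _ using hz
    · have hsmall : ∀ᶠ z : ℝ × X in 𝓝 (0, x), |z.1 * q z.2| < L := by
        have hc : ContinuousAt (fun z : ℝ × X => |z.1 * q z.2|) (0, x) := by fun_prop
        exact hc.eventually_lt_const (by simpa using hL)
      have hpos : ∀ᶠ z : ℝ × X in 𝓝 (0, x), 0 < r z.2 * q z.2 := by
        have hc : ContinuousAt (fun z : ℝ × X => r z.2 * q z.2) (0, x) := by fun_prop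
        exact hc.eventually_const_lt (hsign x hx heq)
      filter_upwards [hsmall, hpos] with z hz hrq hzK hz₀
      have hr_le := abs_le.1 (hle _ hzK)
      rw [abs_lt] at hz ⊢
      rcases pos_and_pos_or_neg_and_neg_of_mul_pos hrq with ⟨_, hq₀⟩ | ⟨_, hq₀⟩
      · have := mul_pos hz₀ hq₀
        constructor <;> linarith [hr_le.1, hr_le.2, hz.1, hz.2]
      · have := mul_neg_of_pos_of_neg hz₀ hq₀
        constructor <;> linarith [hr_le.1, hr_le.2, hz.1, hz.2]
  obtain ⟨ε, hε, hε₀⟩ := ((key.filter_mono nhdsWithin_le_nhds).and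
    (self_mem_nhdsWithin (s := Ioi (0 : ℝ)))).exists
  exact ⟨ε, fun x hx => hε x hx hx hε₀⟩

namespace IsBestEvenApprox

variable {m : ℕ} {a L : ℝ} {Q : ℝ[X]}

/-- If there were fewer extremal points, interpolating the error at them by an even polynomial would
give a direction in which the approximation improves. -/
lemma add_one_lt_card (h : IsBestEvenApprox m a L Q) (hL : 0 < L) {s : Finset ℝ}
    (hs : ∀ t ∈ Icc a 1, |(evenError Q).eval t| = L → t ∈ s) (hs' : ∀ t ∈ s, 0 < t) :
    m + 1 < s.card := by
  by_contra! hcard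
  have hinj : InjOn (fun t : ℝ => t ^ 2) s := fun t ht u hu =>
    (sq_eq_sq₀ (hs' t ht).le (hs' u hu).le).1
  let q := Lagrange.interpolate s (fun t : ℝ => t ^ 2) (fun t => (evenError Q).eval t)
  have hq : q.natDegree ≤ m := degree_lt_add_one_iff_natDegree_le.1
    ((Lagrange.degree_interpolate_lt _ hinj).trans_le (Nat.cast_le.2 hcard))
  obtain ⟨ε, hε⟩ := exists_perturbation_lt (K := Icc a 1) isCompact_Icc
    (r := fun t => (evenError Q).eval t) (q := fun t => q.eval (t ^ 2)) (by fun_prop)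
    (by fun_prop) hL h.abs_le fun t ht htL => by
      rw [Lagrange.eval_interpolate_at_node _ hinj (hs t ht htL)]
      exact mul_self_pos.2 (abs_pos.1 (htL ▸ hL))
  obtain ⟨t, ht, hle⟩ := h.exists_le (Q - C ε * q)
    ((natDegree_sub_le _ _).trans (max_le h.natDegree_le ((natDegree_C_mul_le _ _).trans hq)))
  have hval : (evenError (Q - C ε * q)).eval t = (evenError Q).eval t - ε * q.eval (t ^ 2) := by
    simp only [eval_evenError, eval_sub, eval_mul, eval_C]
    ring
  exact hle.not_gt (hval ▸ hε t ht)

lemma mem_insert_criticalPoints (h : IsBestEvenApprox m a L Q) (ha : 0 < a) {t : ℝ}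
    (ht : t ∈ Icc a 1) (htL : |(evenError Q).eval t| = L) :
    t ∈ insert a (insert 1 (criticalPoints Q)) := by
  rcases ht.1.eq_or_lt with rfl | hat
  · simp
  rcases ht.2.eq_or_lt with rfl | ht1
  · simp
  have hnhds : Icc a 1 ∈ 𝓝 t := Icc_mem_nhds hat ht1
  have hextr : IsLocalExtr (fun t => (evenError Q).eval t) t := by
    rcases abs_choice ((evenError Q).eval t) with hsign | hsign
    · refine Or.inr ?_
      filter_upwards [hnhds] with u hu
      exact (le_abs_self _).trans ((h.abs_le u hu).trans (by rw [← htL, hsign]))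
    · refine Or.inl ?_
      filter_upwards [hnhds] with u hu
      linarith [neg_abs_le ((evenError Q).eval u), h.abs_le u hu]
  have hcrit : t ∈ criticalPoints Q :=
    mem_criticalPoints.2 ⟨ha.trans hat, hextr.hasDerivAt_eq_zero ((evenError Q).hasDerivAt t)⟩
  simp [hcrit]

/-- The upper bound `m` for the number of critical points and the lower bound `m + 2` for the number
of extremal points leave no slack. -/
lemma card_nodes (h : IsBestEvenApprox m a L Q) (hm : 1 ≤ m) (ha : 0 < a) (ha' : a < 1)
    (hL : 0 < L) :
    (insert a (insert 1 (criticalPoints Q))).card = m + 2 ∧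
      ∀ t ∈ insert a (insert 1 (criticalPoints Q)),
        t ∈ Icc a 1 ∧ |(evenError Q).eval t| = L := by
  classical
  set N := insert a (insert 1 (criticalPoints Q))
  have hN : ∀ t ∈ N, 0 < t := by
    intro t ht
    rcases Finset.mem_insert.1 ht with rfl | ht
    · exact ha
    rcases Finset.mem_insert.1 ht with rfl | ht
    · exact one_pos
    · exact (mem_criticalPoints.1 ht).1
  have hle : N.card ≤ m + 2 :=
    (Finset.card_insert_le _ _).trans (Nat.succ_le_succ ((Finset.card_insert_le _ _).trans
      (Nat.succ_le_succ (card_criticalPoints_le hm h.natDegree_le))))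
  have hlt : m + 1 < {t ∈ N | t ∈ Icc a 1 ∧ |(evenError Q).eval t| = L}.card :=
    h.add_one_lt_card hL
      (fun t ht htL => Finset.mem_filter.2 ⟨h.mem_insert_criticalPoints ha ht htL, ht, htL⟩)
      fun t ht => hN t (Finset.mem_of_mem_filter t ht)
  have hge : {t ∈ N | t ∈ Icc a 1 ∧ |(evenError Q).eval t| = L}.card ≤ N.card :=
    Finset.card_filter_le _ _
  refine ⟨by lia, Finset.card_filter_eq_iff.1 (by lia)⟩

end IsBestEvenApprox

lemma pos_of_isPreconnected_of_ne_zero {X : Type*} [TopologicalSpace X] {f : X → ℝ} {s : Set X}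
    (hs : IsPreconnected s) (hf : ContinuousOn f s) (hne : ∀ t ∈ s, f t ≠ 0) {c : X} (hc : c ∈ s)
    (hfc : 0 < f c) {t : X} (ht : t ∈ s) : 0 < f t := by
  by_contra! hle
  obtain ⟨u, hu, hu₀⟩ := hs.intermediate_value ht hc hf ⟨hle, hfc.le⟩
  exact hne u hu hu₀

/-- The error `Q(x²) - x` attains `±L` at the nodes `a = x₀ < ⋯ < x_{m+1} = 1`, does not exceed `L`
on `[a, 1]`, and the interior nodes `x₁, …, x_m` are its only positive critical points. -/
structure Equioscillates (m : ℕ) (a L : ℝ) (Q : ℝ[X]) (x : Fin (m + 2) → ℝ) : Prop where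
  one_le : 1 ≤ m
  pos : 0 < a
  error_pos : 0 < L
  natDegree_le : Q.natDegree ≤ m
  strictMono : StrictMono x
  node_zero : x 0 = a
  node_last : x (Fin.last _) = 1
  abs_node : ∀ j, |(evenError Q).eval (x j)| = L
  abs_le : ∀ t ∈ Icc a 1, |(evenError Q).eval t| ≤ L
  mem_criticalPoints_iff : ∀ t, t ∈ criticalPoints Q ↔ ∃ j : Fin m, x j.castSucc.succ = t

lemma IsBestEvenApprox.notMem_criticalPoints {m : ℕ} {a L : ℝ} {Q : ℝ[X]}
    (h : IsBestEvenApprox m a L Q) (hm : 1 ≤ m) (ha : 0 < a) (ha' : a < 1) (hL : 0 < L) :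
    a ∉ criticalPoints Q ∧ 1 ∉ criticalPoints Q := by
  have hcard := (h.card_nodes hm ha ha' hL).1
  have hcrit_card := card_criticalPoints_le hm h.natDegree_le
  refine ⟨fun hmem => ?_, fun hmem => ?_⟩
  · rw [Finset.insert_eq_of_mem (Finset.mem_insert_of_mem hmem)] at hcard
    have := Finset.card_insert_le 1 (criticalPoints Q)
    lia
  · rw [Finset.insert_eq_of_mem hmem] at hcard
    have := Finset.card_insert_le a (criticalPoints Q)
    lia

lemma IsBestEvenApprox.exists_equioscillates {m : ℕ} {a L : ℝ} {Q : ℝ[X]}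
    (h : IsBestEvenApprox m a L Q) (hm : 1 ≤ m) (ha : 0 < a) (ha' : a < 1) (hL : 0 < L) :
    ∃ x, Equioscillates m a L Q x := by
  obtain ⟨hcard, hN⟩ := h.card_nodes hm ha ha' hL
  obtain ⟨ha_crit, h1_crit⟩ := h.notMem_criticalPoints hm ha ha' hL
  set N := insert a (insert 1 (criticalPoints Q))
  let x := N.orderEmbOfFin hcard
  have hx : StrictMono x := x.strictMono
  have hxN (j) : x j ∈ N := Finset.orderEmbOfFin_mem N hcard j
  have hsurj : ∀ t ∈ N, ∃ j, x j = t := fun t ht => by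
    rwa [← Finset.mem_coe, ← Finset.range_orderEmbOfFin N hcard] at ht
  have hx₀ : x 0 = a := by
    obtain ⟨j, hj⟩ := hsurj a (by simp [N])
    exact le_antisymm ((hx.monotone (Fin.zero_le j)).trans_eq hj) (hN _ (hxN 0)).1.1
  have hx₁ : x (Fin.last _) = 1 := by
    obtain ⟨j, hj⟩ := hsurj 1 (by simp [N])
    exact le_antisymm (hN _ (hxN _)).1.2 (hj.symm.trans_le (hx.monotone (Fin.le_last j)))
  refine ⟨x, hm, ha, hL, h.natDegree_le, hx, hx₀, hx₁, fun j => (hN _ (hxN j)).2, h.abs_le,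
    fun t => ⟨fun ht => ?_, ?_⟩⟩
  · obtain ⟨j, rfl⟩ := hsurj t (by simp [N, ht])
    obtain ⟨i, rfl⟩ := Fin.exists_succ_eq.2 fun hj : j = 0 => ha_crit (by rwa [← hx₀, ← hj])
    obtain ⟨k, rfl⟩ := Fin.exists_castSucc_eq.2 fun hi : i = Fin.last m =>
      h1_crit (by rwa [← hx₁, ← Fin.succ_last, ← hi])
    exact ⟨k, rfl⟩
  · rintro ⟨j, rfl⟩
    have hne₀ : x j.castSucc.succ ≠ a := hx₀ ▸ hx.injective.ne (Fin.succ_ne_zero _)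
    have hne₁ : x j.castSucc.succ ≠ 1 := hx₁ ▸ hx.injective.ne fun hj =>
      (Fin.castSucc_lt_last j).ne (Fin.succ_injective _ (hj.trans (Fin.succ_last _).symm))
    simpa [N, hne₀, hne₁] using hxN j.castSucc.succ

namespace Equioscillates

variable {m : ℕ} {a L : ℝ} {Q : ℝ[X]} {x : Fin (m + 2) → ℝ}

section

variable (h : Equioscillates m a L Q x)
include h

lemma lt_one : a < 1 := by
  rw [← h.node_zero, ← h.node_last]
  exact h.strictMono (Fin.last_pos)

lemma node_mem (j : Fin (m + 2)) : x j ∈ Icc a 1 :=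
  ⟨h.node_zero ▸ h.strictMono.monotone (Fin.zero_le j),
    h.node_last ▸ h.strictMono.monotone (Fin.le_last j)⟩

lemma node_pos (j : Fin (m + 2)) : 0 < x j := h.pos.trans_le (h.node_mem j).1

lemma derivative_ne_zero_of_mem_Ioo (j : Fin (m + 1)) {t : ℝ}
    (ht : t ∈ Ioo (x j.castSucc) (x j.succ)) : (derivative (evenError Q)).eval t ≠ 0 := by
  intro h₀
  obtain ⟨k, rfl⟩ :=
    (h.mem_criticalPoints_iff t).1 (mem_criticalPoints.2 ⟨(h.node_pos _).trans ht.1, h₀⟩)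
  have hlt := h.strictMono.lt_iff_lt.1 ht.1
  have hgt := h.strictMono.lt_iff_lt.1 ht.2
  simp only [Fin.lt_def, Fin.val_castSucc, Fin.val_succ] at hlt hgt
  lia

lemma derivative_neg_left {t : ℝ} (ht : t ∈ Ico 0 (x 1)) :
    (derivative (evenError Q)).eval t < 0 := by
  have hne : ∀ s ∈ Ico 0 (x 1), -(derivative (evenError Q)).eval s ≠ 0 := by
    intro s hs h₀
    rw [neg_eq_zero] at h₀
    rcases hs.1.eq_or_lt with rfl | hs_pos
    · rw [eval_derivative_evenError] at h₀
      norm_num at h₀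
    · obtain ⟨k, rfl⟩ := (h.mem_criticalPoints_iff s).1 (mem_criticalPoints.2 ⟨hs_pos, h₀⟩)
      have hlt := h.strictMono.lt_iff_lt.1 hs.2
      simp [Fin.lt_def] at hlt
  refine neg_pos.1 (pos_of_isPreconnected_of_ne_zero (f := fun s =>
    -(derivative (evenError Q)).eval s) isPreconnected_Ico (by fun_prop) hne
    ⟨le_rfl, h.node_pos 1⟩ ?_ ht)
  rw [eval_derivative_evenError]
  norm_num

lemma strictAntiOn_left : StrictAntiOn (evenError Q).eval (Icc 0 (x 1)) := by
  refine strictAntiOn_of_deriv_neg (convex_Icc _ _) (evenError Q).continuous.continuousOn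
    fun t ht => ?_
  rw [interior_Icc] at ht
  rw [Polynomial.deriv]
  exact h.derivative_neg_left ⟨ht.1.le, ht.2⟩

lemma eval_node_succ (j : Fin (m + 1)) :
    (evenError Q).eval (x j.succ) = -(evenError Q).eval (x j.castSucc) := by
  refine (abs_eq_abs.1 ((h.abs_node _).trans (h.abs_node _).symm)).resolve_left fun heq => ?_
  obtain ⟨c, hc, hc'⟩ := exists_hasDerivAt_eq_zero (h.strictMono (Fin.castSucc_lt_succ (i := j)))
    (evenError Q).continuous.continuousOn heq.symm fun t _ => (evenError Q).hasDerivAt t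
  exact h.derivative_ne_zero_of_mem_Ioo j hc hc'

lemma eval_left_endpoint : (evenError Q).eval a = L := by
  have hlt : (evenError Q).eval (x 1) < (evenError Q).eval (x 0) :=
    h.strictAntiOn_left ⟨(h.node_pos 0).le, h.strictMono.monotone (Fin.zero_le 1)⟩
      ⟨(h.node_pos 1).le, le_rfl⟩ (h.strictMono Fin.zero_lt_one)
  have hsucc : (evenError Q).eval (x 1) = -(evenError Q).eval (x 0) := h.eval_node_succ 0
  rw [← h.node_zero, ← h.abs_node 0, abs_of_pos (by linarith)]

lemma eval_node (j : Fin (m + 2)) : (evenError Q).eval (x j) = (-1) ^ (j : ℕ) * L := by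
  induction j using Fin.induction with
  | zero => simpa [h.node_zero] using h.eval_left_endpoint
  | succ j ih => rw [h.eval_node_succ, ih, Fin.val_succ, Fin.val_castSucc, pow_succ]; ring

lemma neg_one_pow_mul_derivative_pos (j : Fin (m + 1)) {s : Set ℝ} (hs : IsPreconnected s)
    (hsub : Ioo (x j.castSucc) (x j.succ) ⊆ s)
    (hne : ∀ t ∈ s, (derivative (evenError Q)).eval t ≠ 0) {t : ℝ} (ht : t ∈ s) :
    0 < (-1) ^ (j + 1 : ℕ) * (derivative (evenError Q)).eval t := by
  have hlt : x j.castSucc < x j.succ := h.strictMono Fin.castSucc_lt_succ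
  obtain ⟨c, hc, hslope⟩ := exists_hasDerivAt_eq_slope _ _ hlt
    (evenError Q).continuous.continuousOn fun t _ => (evenError Q).hasDerivAt t
  refine pos_of_isPreconnected_of_ne_zero
    (f := fun t => (-1) ^ (j + 1 : ℕ) * (derivative (evenError Q)).eval t) hs (by fun_prop)
    (fun t ht => mul_ne_zero (pow_ne_zero _ (by norm_num)) (hne t ht)) (hsub hc) ?_ ht
  have hsq : ((-1 : ℝ) ^ (j : ℕ)) * (-1) ^ (j : ℕ) = 1 := by rw [← mul_pow]; norm_num
  have hjump : (-1) ^ (j + 1 : ℕ) *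
      ((evenError Q).eval (x j.succ) - (evenError Q).eval (x j.castSucc)) = 2 * L := by
    rw [h.eval_node_succ, h.eval_node, Fin.val_castSucc, pow_succ]
    linear_combination 2 * L * hsq
  rw [hslope, ← mul_div_assoc, hjump]
  exact div_pos (mul_pos two_pos h.error_pos) (sub_pos.2 hlt)

lemma derivative_sign_between (j : Fin (m + 1)) {t : ℝ} (ht : t ∈ Ioo (x j.castSucc) (x j.succ)) :
    0 < (-1) ^ (j + 1 : ℕ) * (derivative (evenError Q)).eval t :=
  h.neg_one_pow_mul_derivative_pos j isPreconnected_Ioo subset_rfl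
    (fun _ => h.derivative_ne_zero_of_mem_Ioo j) ht

lemma derivative_sign_right {t : ℝ} (ht : 1 ≤ t) :
    0 < (-1) ^ (m + 1) * (derivative (evenError Q)).eval t := by
  refine h.neg_one_pow_mul_derivative_pos (Fin.last m) (isPreconnected_Ioi
    (a := x (Fin.last m).castSucc)) (fun s hs => hs.1) (fun s hs h₀ => ?_) ?_
  · obtain ⟨k, rfl⟩ := (h.mem_criticalPoints_iff s).1
      (mem_criticalPoints.2 ⟨(h.node_pos _).trans hs, h₀⟩)
    have hlt := h.strictMono.lt_iff_lt.1 hs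
    simp only [Fin.lt_def, Fin.val_castSucc, Fin.val_succ, Fin.val_last] at hlt
    lia
  · rw [← h.node_last] at ht
    exact (h.strictMono (Fin.castSucc_lt_last _)).trans_le ht

/-- `Q'` interpolates `1 / (2 √t)` at the squares of the interior nodes. -/
lemma neg_one_pow_mul_iterate_derivative_pos {k : ℕ} (hk : k < m) {t : ℝ} (ht : t ≤ 0) :
    0 < (-1) ^ k * (derivative^[k + 1] Q).eval t := by
  obtain ⟨n, rfl⟩ : ∃ n, m = n + 1 := ⟨m - 1, by lia⟩
  have hz : StrictMono fun j : Fin (n + 1) => x j.castSucc.succ ^ 2 := fun i j hij =>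
    pow_lt_pow_left₀ (h.strictMono (Fin.succ_lt_succ_iff.2 hij)) (h.node_pos _).le two_ne_zero
  refine neg_one_pow_mul_iterate_derivative_pos_of_eval_eq_rpow (Q := derivative Q) (c := 1 / 2)
    (α := -(1 / 2)) ?_ (by norm_num) (by norm_num) hz (pow_pos (h.node_pos _) 2) (fun j => ?_)
    (Nat.lt_succ_iff.1 hk) (ht.trans (pow_pos (h.node_pos _) 2).le)
  · have := natDegree_derivative_le Q
    have := h.natDegree_le
    lia
  · exact (eval_derivative_evenError_eq_zero_iff (h.node_pos _)).1
      (mem_criticalPoints.1 ((h.mem_criticalPoints_iff _).2 ⟨j, rfl⟩)).2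

lemma derivative_pos {t : ℝ} (ht : t ≤ 0) : 0 < (derivative Q).eval t := by
  simpa using h.neg_one_pow_mul_iterate_derivative_pos (k := 0) h.one_le ht

lemma derivative_derivative_nonpos {t : ℝ} (ht : t ≤ 0) :
    (derivative (derivative Q)).eval t ≤ 0 := by
  rcases h.one_le.eq_or_lt with rfl | hm
  · have : (derivative Q).natDegree = 0 := by
      have := natDegree_derivative_le Q
      have := h.natDegree_le
      lia
    rw [derivative_of_natDegree_zero this, eval_zero]
  · have := h.neg_one_pow_mul_iterate_derivative_pos hm ht
    simp only [Function.iterate_succ, Function.iterate_zero, Function.comp_apply, id_eq] at this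
    linarith

end

end Equioscillates

/-! ### Uniqueness of the best approximation -/

lemma neg_one_pow_mul_prod_sub_pos {F : Type*} [CommRing F] [LinearOrder F] [IsStrictOrderedRing F]
    {n : ℕ} {y : Fin (n + 1) → F} (hy : StrictMono y) (i : Fin (n + 1)) :
    0 < (-1) ^ (n - i : ℕ) * ∏ j ∈ Finset.univ.erase i, (y i - y j) := by
  have hsplit : Finset.univ.erase i = (Finset.Iio i).disjUnion (Finset.Ioi i)
      (Finset.disjoint_left.2 fun j hj hj' =>
        (Finset.mem_Iio.1 hj).not_gt (Finset.mem_Ioi.1 hj')) := by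
    ext j
    simp [lt_or_lt_iff_ne]
  have hsign : (-1 : F) ^ (n - i : ℕ) = ∏ _j ∈ Finset.Ioi i, (-1 : F) := by
    rw [Finset.prod_const, Fin.card_Ioi, Nat.add_sub_cancel]
  rw [hsplit, Finset.prod_disjUnion, hsign, mul_left_comm, ← Finset.prod_mul_distrib]
  refine mul_pos (Finset.prod_pos fun j hj => sub_pos.2 (hy (Finset.mem_Iio.1 hj)))
    (Finset.prod_pos fun j hj => ?_)
  rw [neg_one_mul, neg_sub]
  exact sub_pos.2 (hy (Finset.mem_Ioi.1 hj))

/-- In the Lagrange formula for the vanishing coefficient of degree `n + 1`, all summands have the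
same sign. -/
lemma eq_zero_of_weakly_alternating {F : Type*} [Field F] [LinearOrder F] [IsStrictOrderedRing F]
    {n : ℕ} {D : F[X]} (hD : D.natDegree ≤ n) {y : Fin (n + 2) → F} (hy : StrictMono y)
    (hsign : ∀ k : Fin (n + 2), 0 ≤ (-1) ^ (k : ℕ) * D.eval (y k)) : D = 0 := by
  have hdeg : D.degree < (Finset.univ : Finset (Fin (n + 2))).card := by
    rw [Finset.card_univ, Fintype.card_fin, degree_lt_add_one_iff_natDegree_le]
    lia
  have hsum := Lagrange.coeff_eq_sum (s := Finset.univ) hy.injective.injOn hdeg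
  rw [Finset.card_univ, Fintype.card_fin, coeff_eq_zero_of_natDegree_lt (by lia)] at hsum
  have hprod_ne : ∀ i, ∏ j ∈ Finset.univ.erase i, (y i - y j) ≠ 0 := fun i =>
    right_ne_zero_of_mul (neg_one_pow_mul_prod_sub_pos hy i).ne'
  have hterm : ∀ i ∈ Finset.univ, 0 ≤
      (-1) ^ (n + 1) * (D.eval (y i) / ∏ j ∈ Finset.univ.erase i, (y i - y j)) := by
    intro i _
    have hpow : (-1 : F) ^ (n + 1) * (-1) ^ (n + 1 - i : ℕ) = (-1) ^ (i : ℕ) := by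
      rw [← pow_add, show n + 1 + (n + 1 - i) = 2 * (n + 1 - i) + i by lia, pow_add, pow_mul]
      simp
    refine (div_nonneg (hsign i) (neg_one_pow_mul_prod_sub_pos hy i).le).trans_eq ?_
    rw [← hpow, div_eq_iff (neg_one_pow_mul_prod_sub_pos hy i).ne']
    field_simp [hprod_ne i]
  have hzero := (Finset.sum_eq_zero_iff_of_nonneg hterm).1 (by
    rw [← Finset.mul_sum, ← hsum, mul_zero])
  refine eq_zero_of_degree_lt_of_eval_index_eq_zero (v := y) Finset.univ hy.injective.injOn hdeg
    fun i hi => ?_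
  simpa [hprod_ne i] using hzero i hi

lemma eval_add_eval_neg {R : Type*} [CommRing R] (P : R[X]) (t : R) :
    P.eval t + P.eval (-t) = 2 * (contract 2 P).eval (t ^ 2) := by
  have h : P + P.comp (-X) = 2 * expand R 2 (contract 2 P) := by
    ext n
    rw [two_mul, coeff_add, coeff_add, neg_eq_neg_one_mul (X : R[X]), ← C_1, ← C_neg,
      comp_C_mul_X_coeff, coeff_expand two_pos]
    rcases n.even_or_odd with hn | hn
    · rw [if_pos hn.two_dvd, coeff_contract two_ne_zero, Nat.div_mul_cancel hn.two_dvd,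
        hn.neg_one_pow]
      ring
    · rw [if_neg hn.not_two_dvd_nat, hn.neg_one_pow]
      ring
  simpa using congrArg (eval t) h

lemma natDegree_contract_le {R : Type*} [CommSemiring R] {P : R[X]} {p n : ℕ} (hp : p ≠ 0)
    (hP : P.natDegree ≤ p * n) : (contract p P).natDegree ≤ n :=
  natDegree_le_iff_coeff_eq_zero.2 fun N hN => by
    rw [coeff_contract hp]
    exact coeff_eq_zero_of_natDegree_lt (hP.trans_lt (by
      rw [mul_comm N]
      exact Nat.mul_lt_mul_of_pos_left hN (Nat.pos_of_ne_zero hp)))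

lemma abs_mem_Icc_of_mem_twoIntervals {a t : ℝ} (ha : 0 < a) (ht : t ∈ twoIntervals a) :
    |t| ∈ Icc a 1 := by
  rcases ht with ht | ht
  · rw [abs_of_nonpos (by linarith [ht.2])]
    exact ⟨by linarith [ht.2], by linarith [ht.1]⟩
  · rwa [abs_of_nonneg (by linarith [ht.1])]

lemma abs_sub_eval_le_deviation (a : ℝ) (P : ℝ[X]) {t : ℝ} (ht : t ∈ twoIntervals a) :
    |(|t|) - P.eval t| ≤ deviation a P := by
  refine le_csSup ?_ (mem_image_of_mem _ ht)
  refine (IsCompact.image_of_continuousOn (isCompact_Icc.union isCompact_Icc) ?_).bddAbove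
  fun_prop

namespace Equioscillates

variable {m : ℕ} {a L : ℝ} {Q : ℝ[X]} {x : Fin (m + 2) → ℝ}

section

variable (h : Equioscillates m a L Q x)
include h

lemma natDegree_comp_le : (Q.comp (X ^ 2)).natDegree ≤ 2 * m := by
  rw [natDegree_comp, natDegree_X_pow, mul_comm]
  exact Nat.mul_le_mul_left 2 h.natDegree_le

lemma eq_of_abs_eval_evenError_le {R : ℝ[X]} (hR : R.natDegree ≤ m)
    (hle : ∀ t ∈ Icc a 1, |(evenError R).eval t| ≤ L) : R = Q := by
  have hy : StrictMono fun j => x j ^ 2 := fun i j hij =>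
    pow_lt_pow_left₀ (h.strictMono hij) (h.node_pos i).le two_ne_zero
  refine (sub_eq_zero.1 (eq_zero_of_weakly_alternating
    ((natDegree_sub_le _ _).trans (max_le h.natDegree_le hR)) hy fun (k : Fin (m + 2)) => ?_)).symm
  have hk := h.eval_node k
  have hRk := _root_.abs_le.1 (hle _ (h.node_mem k))
  rw [eval_evenError] at hk hRk
  rw [eval_sub]
  rcases neg_one_pow_eq_or ℝ k with hsign | hsign <;> rw [hsign] at hk ⊢ <;>
    linarith [hRk.1, hRk.2]

/-- The even part of a competitor `P` is also a competitor, so it is `Q(x²)`. At each node the mean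
of the errors at `±x_j` is then extremal, hence both errors are, and `P - Q(x²)` has `2 m + 4`
zeros. -/
lemma eq_of_abs_sub_eval_le {P : ℝ[X]} (hP : P.natDegree ≤ 2 * m)
    (hle : ∀ t ∈ twoIntervals a, |(|t|) - P.eval t| ≤ L) : P = Q.comp (X ^ 2) := by
  have hpos : ∀ t ∈ Icc a 1, |t - P.eval t| ≤ L ∧ |t - P.eval (-t)| ≤ L := fun t ht => by
    have habs : |t| = t := abs_of_nonneg (h.pos.le.trans ht.1)
    have hneg := hle (-t) (Or.inl ⟨neg_le_neg ht.2, neg_le_neg ht.1⟩)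
    rw [abs_neg, habs] at hneg
    have hpos := hle t (Or.inr ht)
    rw [habs] at hpos
    exact ⟨hpos, hneg⟩
  have heven : contract 2 P = Q := by
    refine h.eq_of_abs_eval_evenError_le (natDegree_contract_le two_ne_zero hP) fun t ht => ?_
    have hsum := eval_add_eval_neg P t
    obtain ⟨h₁, h₂⟩ := hpos t ht
    rw [eval_evenError]
    rw [_root_.abs_le] at h₁ h₂ ⊢
    constructor <;> linarith [h₁.1, h₁.2, h₂.1, h₂.2]
  have hnode : ∀ j, P.eval (x j) = Q.eval (x j ^ 2) ∧ P.eval (-x j) = Q.eval (x j ^ 2) := by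
    intro j
    have hsum := eval_add_eval_neg P (x j)
    have hj := h.eval_node j
    obtain ⟨h₁, h₂⟩ := hpos _ (h.node_mem j)
    rw [heven] at hsum
    rw [eval_evenError] at hj
    rw [_root_.abs_le] at h₁ h₂
    rcases neg_one_pow_eq_or ℝ j with hsign | hsign <;> rw [hsign] at hj <;>
      constructor <;> linarith [h₁.1, h₁.2, h₂.1, h₂.2]
  have hinj : Function.Injective (Sum.elim x fun j => -x j) :=
    h.strictMono.injective.sumElim (neg_injective.comp h.strictMono.injective)
      fun i j => (by linarith [h.node_pos i, h.node_pos j] : -x j < x i).ne'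
  refine sub_eq_zero.1 (eq_zero_of_natDegree_lt_card_of_eval_eq_zero _ hinj ?_ ?_)
  · rintro (j | j) <;> simp [hnode j]
  · refine ((natDegree_sub_le _ _).trans (max_le hP h.natDegree_comp_le)).trans_lt ?_
    simp only [Fintype.card_sum, Fintype.card_fin]
    lia

lemma deviation_comp_eq : deviation a (Q.comp (X ^ 2)) = L := by
  have ha : a ∈ twoIntervals a := Or.inr ⟨le_rfl, h.lt_one.le⟩
  have heval : ∀ t, |(|t|) - (Q.comp (X ^ 2)).eval t| = |(evenError Q).eval (|t|)| := fun t => by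
    rw [eval_evenError, sq_abs, abs_sub_comm, eval_comp, eval_pow, eval_X]
  refine IsGreatest.csSup_eq ⟨⟨a, ha, ?_⟩, ?_⟩
  · beta_reduce
    rw [heval, abs_of_pos h.pos, h.eval_left_endpoint, abs_of_pos h.error_pos]
  · rintro _ ⟨t, ht, rfl⟩
    beta_reduce
    rw [heval]
    exact h.abs_le _ (abs_mem_Icc_of_mem_twoIntervals h.pos ht)

lemma eq_of_deviation_le {P : ℝ[X]} (hP : P.natDegree ≤ 2 * m) (hle : deviation a P ≤ L) :
    P = Q.comp (X ^ 2) :=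
  h.eq_of_abs_sub_eval_le hP fun _ ht => (abs_sub_eval_le_deviation a P ht).trans hle

lemma approxError_eq : approxError m a = L := by
  refine IsLeast.csInf_eq ⟨⟨_, h.natDegree_comp_le, h.deviation_comp_eq⟩, ?_⟩
  rintro _ ⟨P, hP, rfl⟩
  by_contra! hlt
  rw [h.eq_of_deviation_le hP hlt.le, h.deviation_comp_eq] at hlt
  exact lt_irrefl _ hlt

lemma isBestApprox_iff {P : ℝ[X]} : IsBestApprox m a P ↔ P = Q.comp (X ^ 2) := by
  refine ⟨fun hP => h.eq_of_deviation_le hP.1 (hP.2.trans h.approxError_eq).le, ?_⟩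
  rintro rfl
  exact ⟨h.natDegree_comp_le, h.deviation_comp_eq.trans h.approxError_eq.symm⟩

end

end Equioscillates

/-! ### Holomorphic functions on the first quadrant -/

lemma openQuadrant_eq : openQuadrant = Ioi 0 ×ℂ Ioi 0 := rfl

lemma closedQuadrant_eq : closedQuadrant = Ici 0 ×ℂ Ici 0 := rfl

lemma isOpen_openQuadrant : IsOpen openQuadrant := isOpen_Ioi.reProdIm isOpen_Ioi

lemma isClosed_closedQuadrant : IsClosed closedQuadrant := isClosed_Ici.reProdIm isClosed_Ici

lemma closure_openQuadrant : closure openQuadrant = closedQuadrant := by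
  rw [openQuadrant_eq, Complex.closure_reProdIm, closure_Ioi, closedQuadrant_eq]

lemma openQuadrant_subset_closedQuadrant : openQuadrant ⊆ closedQuadrant :=
  fun _ hz => ⟨hz.1.le, hz.2.le⟩

lemma convex_openQuadrant : Convex ℝ openQuadrant :=
  (convex_halfSpace_re_gt 0).inter (convex_halfSpace_im_gt 0)

lemma convex_closedQuadrant : Convex ℝ closedQuadrant :=
  (convex_halfSpace_re_ge 0).inter (convex_halfSpace_im_ge 0)

lemma isPreconnected_openQuadrant : IsPreconnected openQuadrant :=
  convex_openQuadrant.isPreconnected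

lemma one_add_I_mem_openQuadrant : 1 + Complex.I ∈ openQuadrant := by simp [openQuadrant]

lemma ofReal_mem_closedQuadrant {x : ℝ} (hx : 0 ≤ x) : (x : ℂ) ∈ closedQuadrant := by
  simp [closedQuadrant, hx]

lemma ofReal_mul_I_mem_closedQuadrant {y : ℝ} (hy : 0 ≤ y) :
    (y : ℂ) * Complex.I ∈ closedQuadrant := by
  simp [closedQuadrant, hy]

lemma norm_exp_neg_le_one_iff {w : ℂ} : ‖Complex.exp (-w)‖ ≤ 1 ↔ 0 ≤ w.re := by
  rw [Complex.norm_exp, Real.exp_le_one_iff, Complex.neg_re, neg_nonpos]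

lemma re_pos_of_re_nonneg {U : Set ℂ} (hU : IsOpen U) (hconn : IsPreconnected U) {f : ℂ → ℂ}
    (hf : DifferentiableOn ℂ f U) (hnonneg : ∀ z ∈ U, 0 ≤ (f z).re) {z₀ : ℂ} (hz₀ : z₀ ∈ U)
    (hpos : 0 < (f z₀).re) {z : ℂ} (hz : z ∈ U) : 0 < (f z).re := by
  refine (hnonneg z hz).lt_of_ne' fun hzero => ?_
  have hnorm : ‖Complex.exp (-f z)‖ = 1 := by simp [Complex.norm_exp, hzero]
  have hmax : IsMaxOn (norm ∘ fun w => Complex.exp (-f w)) U z := fun w hw =>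
    (norm_exp_neg_le_one_iff.2 (hnonneg w hw)).trans hnorm.ge
  have hconst := Complex.norm_eqOn_of_isPreconnected_of_isMaxOn hconn hU hf.neg.cexp hz hmax hz₀
  simp only [Function.comp_apply, Function.const_apply, Pi.neg_apply, Complex.norm_exp,
    Complex.neg_re, Real.exp_eq_exp, neg_inj] at hconst
  exact hpos.ne' (hconst.trans hzero)

/-- Phragmén–Lindelöf for `exp (-f)`. -/
lemma re_nonneg_of_re_nonneg_on_axes {f : ℂ → ℂ} (hd : DifferentiableOn ℂ f openQuadrant)
    (hc : ContinuousOn f closedQuadrant) (hgrowth : f =O[Bornology.cobounded ℂ ⊓ 𝓟 openQuadrant] id)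
    (hre : ∀ x : ℝ, 0 ≤ x → 0 ≤ (f x).re) (him : ∀ y : ℝ, 0 ≤ y → 0 ≤ (f (y * Complex.I)).re)
    {z : ℂ} (hz : z ∈ closedQuadrant) : 0 ≤ (f z).re := by
  rw [← norm_exp_neg_le_one_iff]
  obtain ⟨B, hB⟩ := hgrowth.bound
  refine PhragmenLindelof.quadrant_I (f := fun z => Complex.exp (-f z)) (C := 1)
    ⟨hd.neg.cexp, by rw [← openQuadrant_eq, closure_openQuadrant]; exact hc.neg.cexp⟩
    ⟨1, one_lt_two, B, .of_bound 1 ?_⟩ (fun x hx => norm_exp_neg_le_one_iff.2 (hre x hx))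
    (fun y hy => norm_exp_neg_le_one_iff.2 (him y hy)) hz.1 hz.2
  rw [← openQuadrant_eq]
  filter_upwards [hB] with w hw
  rw [Complex.norm_exp, Real.norm_of_nonneg (Real.exp_pos _).le, one_mul, Real.rpow_one,
    Real.exp_le_exp]
  exact (Complex.re_le_norm _).trans (by rwa [norm_neg])

lemma re_pos_of_re_nonneg_on_axes {f : ℂ → ℂ} (hd : DifferentiableOn ℂ f openQuadrant)
    (hc : ContinuousOn f closedQuadrant) (hgrowth : f =O[Bornology.cobounded ℂ ⊓ 𝓟 openQuadrant] id)
    (hre : ∀ x : ℝ, 0 ≤ x → 0 ≤ (f x).re) (him : ∀ y : ℝ, 0 ≤ y → 0 ≤ (f (y * Complex.I)).re)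
    {z₀ : ℂ} (hz₀ : z₀ ∈ closedQuadrant) (hpos : 0 < (f z₀).re) {z : ℂ} (hz : z ∈ openQuadrant) :
    0 < (f z).re := by
  have hnonneg := fun w hw => re_nonneg_of_re_nonneg_on_axes hd hc hgrowth hre him
    (openQuadrant_subset_closedQuadrant (a := w) hw)
  have : (𝓝[openQuadrant] z₀).NeBot := mem_closure_iff_nhdsWithin_neBot.1
    (by rwa [closure_openQuadrant])
  have hev : ∀ᶠ w in 𝓝[openQuadrant] z₀, 0 < (f w).re :=
    ((Complex.continuous_re.tendsto _).comp
      ((hc z₀ hz₀).mono openQuadrant_subset_closedQuadrant)).eventually_const_lt hpos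
  obtain ⟨w, hwpos, hw⟩ := (hev.and self_mem_nhdsWithin).exists
  exact re_pos_of_re_nonneg isOpen_openQuadrant isPreconnected_openQuadrant hd hnonneg hw hwpos hz

lemma isBigO_id_of_eventually_norm_deriv_le {f : ℂ → ℂ} (hf : DifferentiableOn ℂ f openQuadrant)
    {K : ℝ} (hK : ∀ᶠ z in Bornology.cobounded ℂ ⊓ 𝓟 openQuadrant, ‖deriv f z‖ ≤ K) :
    f =O[Bornology.cobounded ℂ ⊓ 𝓟 openQuadrant] id := by
  obtain ⟨ρ, hρ⟩ := Filter.eventually_atTop.1 (by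
    simpa only [eventually_inf_principal, ← comap_norm_atTop, eventually_comap] using hK)
  set s : Set ℂ := openQuadrant ∩ {z | 2 * ρ ≤ z.re + z.im}
  have hconv : Convex ℝ s := convex_openQuadrant.inter
    (convex_halfSpace_ge ((Complex.reLm + Complex.imLm).isLinear) (2 * ρ))
  have hderiv : ∀ z ∈ s, ‖deriv f z‖ ≤ K := fun z hz => hρ ‖z‖ (by
    linarith [hz.2.out, Complex.re_le_norm z, Complex.im_le_norm z]) z rfl hz.1
  have hmem : ∀ᶠ z in Bornology.cobounded ℂ ⊓ 𝓟 openQuadrant, z ∈ s := by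
    rw [eventually_inf_principal]
    filter_upwards [tendsto_norm_cobounded_atTop.eventually_ge_atTop (2 * ρ)] with z hz hzQ
    refine ⟨hzQ, hz.trans ((Complex.norm_le_abs_re_add_abs_im z).trans_eq ?_)⟩
    rw [abs_of_pos hzQ.1, abs_of_pos hzQ.2]
  have hz₀ : (|ρ| + 1 : ℝ) * (1 + Complex.I) ∈ s := by
    refine ⟨⟨?_, ?_⟩, ?_⟩ <;> simp <;> linarith [le_abs_self ρ, abs_nonneg ρ]
  have hbound : ∀ z ∈ s, ‖f z - f ((|ρ| + 1 : ℝ) * (1 + Complex.I))‖ ≤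
      K * ‖z - (|ρ| + 1 : ℝ) * (1 + Complex.I)‖ := fun z hz =>
    hconv.norm_image_sub_le_of_norm_deriv_le
      (fun w hw => hf.differentiableAt (isOpen_openQuadrant.mem_nhds hw.1)) hderiv hz₀ hz
  have hconst : ∀ c : ℂ, (fun _ : ℂ => c) =O[Bornology.cobounded ℂ ⊓ 𝓟 openQuadrant] id :=
    fun c => ((Asymptotics.isLittleO_const_id_cobounded c).isBigO).mono inf_le_left
  have hsub := (Asymptotics.IsBigO.of_bound K (hmem.mono hbound)).trans
    ((Asymptotics.isBigO_refl _ _).sub (hconst _))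
  exact (hsub.add (hconst _)).congr_left fun z => sub_add_cancel _ _

/-! ### Square roots of polynomials on the quadrant -/

/-- `F` has a square root on the closed quadrant that is continuous up to the boundary and
holomorphic inside. -/
def HasQuadrantSqrt (F : ℂ → ℂ) : Prop :=
  ∃ f : ℂ → ℂ, ContinuousOn f closedQuadrant ∧ DifferentiableOn ℂ f openQuadrant ∧
    ∀ z ∈ closedQuadrant, f z ^ 2 = F z

lemma hasQuadrantSqrt_const (c : ℂ) : HasQuadrantSqrt fun _ => c :=
  ⟨fun _ => c ^ (2⁻¹ : ℂ), continuousOn_const, differentiableOn_const _, fun _ _ =>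
    Complex.cpow_ofNat_inv_pow c 2⟩

lemma HasQuadrantSqrt.mul {F G : ℂ → ℂ} (hF : HasQuadrantSqrt F) (hG : HasQuadrantSqrt G) :
    HasQuadrantSqrt fun z => F z * G z := by
  obtain ⟨f, hfc, hfd, hf⟩ := hF
  obtain ⟨g, hgc, hgd, hg⟩ := hG
  exact ⟨fun z => f z * g z, hfc.mul hgc, hfd.mul hgd, fun z hz => by
    rw [mul_pow, hf z hz, hg z hz]⟩

lemma hasQuadrantSqrt_of_re_pos {F : ℂ → ℂ} (hF : Differentiable ℂ F)
    (hpos : ∀ z ∈ openQuadrant, 0 < (F z).re) : HasQuadrantSqrt F := by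
  have hnonneg : ∀ z ∈ closedQuadrant, 0 ≤ (F z).re := fun z hz =>
    closure_minimal (fun w hw => (hpos w hw).le)
      (isClosed_le continuous_const (Complex.continuous_re.comp hF.continuous))
      (closure_openQuadrant.ge hz)
  refine ⟨fun z => F z ^ (2⁻¹ : ℂ), fun z hz => ?_, fun z hz => ?_, fun z _ =>
    Complex.cpow_ofNat_inv_pow (F z) 2⟩
  · exact ((Complex.continuousAt_cpow_const_of_re_pos (Or.inl (hnonneg z hz)) (by norm_num)).comp
      hF.continuous.continuousAt).continuousWithinAt
  · exact ((hF z).cpow_const (Or.inl (hpos z hz))).differentiableWithinAt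

lemma hasQuadrantSqrt_sub {r : ℂ} (hr : r ∉ openQuadrant) : HasQuadrantSqrt fun z => z - r := by
  rcases not_and_or.1 hr with hre | him
  · refine hasQuadrantSqrt_of_re_pos (by fun_prop) fun z hz => ?_
    rw [Complex.sub_re]
    linarith [hz.1]
  · have hrot : HasQuadrantSqrt fun z => -Complex.I * (z - r) := by
      refine hasQuadrantSqrt_of_re_pos (by fun_prop) fun z hz => ?_
      simp only [neg_mul, Complex.neg_re, Complex.I_mul_re, Complex.sub_im]
      linarith [hz.2]
    simpa [← mul_assoc] using (hasQuadrantSqrt_const Complex.I).mul hrot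

lemma hasQuadrantSqrt_eval {F : ℂ[X]} (hF : ∀ z ∈ openQuadrant, F.eval z ≠ 0) :
    HasQuadrantSqrt fun z => F.eval z := by
  have hprod : ∀ s : Multiset ℂ, (∀ r ∈ s, r ∉ openQuadrant) →
      HasQuadrantSqrt fun z => (s.map fun r => z - r).prod := by
    intro s
    induction s using Multiset.induction_on with
    | empty => exact fun _ => by simpa using hasQuadrantSqrt_const 1
    | cons r s ih =>
      intro hs
      simpa using (hasQuadrantSqrt_sub (hs r (Multiset.mem_cons_self r s))).mul
        (ih fun q hq => hs q (Multiset.mem_cons_of_mem hq))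
  have hfactor : ∀ z, F.eval z = F.leadingCoeff * (F.roots.map fun r => z - r).prod := fun z => by
    conv_lhs => rw [(IsAlgClosed.splits F).eq_prod_roots]
    simp [eval_multiset_prod, Multiset.map_map]
  simpa only [hfactor] using (hasQuadrantSqrt_const F.leadingCoeff).mul
    (hprod F.roots fun r hr hrQ => hF r hrQ (isRoot_of_mem_roots hr))

/-! ### Branches of the arccosine -/

lemma exists_exp_eq_on_closedQuadrant {J : ℂ → ℂ} (hJ : ContinuousOn J closedQuadrant)
    (hne : ∀ z ∈ closedQuadrant, J z ≠ 0) :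
    ∃ ℓ : ℂ → ℂ, ContinuousOn ℓ closedQuadrant ∧
      ∀ z ∈ closedQuadrant, Complex.exp (ℓ z) = J z := by
  have hmem : (0 : ℂ) ∈ closedQuadrant := ⟨le_rfl, le_rfl⟩
  have : ContractibleSpace closedQuadrant := convex_closedQuadrant.contractibleSpace ⟨0, hmem⟩
  have : LocallyPathConnectedSpace closedQuadrant :=
    convex_closedQuadrant.locallyPathConnectedSpace
  obtain ⟨F, ⟨-, hF⟩, -⟩ := Complex.isCoveringMapOn_exp.existsUnique_continuousMap_lifts
    (A := closedQuadrant) ⟨closedQuadrant.domRestrict J, hJ.domRestrict⟩ (a₀ := ⟨0, hmem⟩)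
    (e₀ := Complex.log (J 0)) (Complex.exp_log (hne 0 hmem)) (fun z => hne z z.2)
  classical
  refine ⟨fun z => if h : z ∈ closedQuadrant then F ⟨z, h⟩ else 0, ?_, fun z hz => ?_⟩
  · rw [continuousOn_iff_continuous_domRestrict]
    convert F.continuous using 1
    ext z
    simp
  · simp only [hz, dif_pos]
    exact congrFun hF ⟨z, hz⟩

lemma differentiableOn_of_exp_eq {s : Set ℂ} (hs : IsOpen s) {ℓ J : ℂ → ℂ} (hℓ : ContinuousOn ℓ s)
    (hJ : DifferentiableOn ℂ J s) (h : ∀ z ∈ s, Complex.exp (ℓ z) = J z) :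
    DifferentiableOn ℂ ℓ s := by
  intro z₀ hz₀
  have hnhds := hs.mem_nhds hz₀
  have hJ₀ : J z₀ ≠ 0 := h z₀ hz₀ ▸ Complex.exp_ne_zero _
  have hcont : ContinuousAt (fun z => (ℓ z - ℓ z₀).im) z₀ :=
    Complex.continuous_im.continuousAt.comp ((hℓ.continuousAt hnhds).sub continuousAt_const)
  have hlog : ∀ᶠ z in 𝓝 z₀, ℓ z = ℓ z₀ + Complex.log (J z / J z₀) := by
    filter_upwards [hnhds, hcont.eventually_lt_const (u := Real.pi) (by simp [Real.pi_pos]),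
      hcont.eventually_const_lt (u := -Real.pi) (by simp [Real.pi_pos])] with z hz hlt hgt
    rw [← h z hz, ← h z₀ hz₀, ← Complex.exp_sub, Complex.log_exp hgt hlt.le, add_sub_cancel]
  have hd : DifferentiableAt ℂ (fun z => ℓ z₀ + Complex.log (J z / J z₀)) z₀ := by
    refine (DifferentiableAt.clog ((hJ.differentiableAt hnhds).div_const _) ?_).const_add _
    rw [div_self hJ₀]
    exact Complex.one_mem_slitPlane
  exact (hd.congr_of_eventuallyEq hlog).differentiableWithinAt

lemma exists_cos_eq_of_sq_eq {s R : ℂ → ℂ} (hs : ContinuousOn s closedQuadrant)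
    (hs' : DifferentiableOn ℂ s openQuadrant) (hR : Differentiable ℂ R)
    (hsq : ∀ z ∈ closedQuadrant, s z ^ 2 = R z ^ 2 - 1) :
    ∃ φ : ℂ → ℂ, ContinuousOn φ closedQuadrant ∧ DifferentiableOn ℂ φ openQuadrant ∧
      ∀ z ∈ closedQuadrant, Complex.cos (φ z) = R z := by
  have hinv : ∀ z ∈ closedQuadrant, (R z + s z) * (R z - s z) = 1 := fun z hz => by
    linear_combination -hsq z hz
  obtain ⟨ℓ, hℓc, hℓ⟩ := exists_exp_eq_on_closedQuadrant (hR.continuous.continuousOn.add hs)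
    fun z hz => left_ne_zero_of_mul_eq_one (hinv z hz)
  refine ⟨fun z => -Complex.I * ℓ z, continuousOn_const.mul hℓc, (differentiableOn_const _).mul
    (differentiableOn_of_exp_eq isOpen_openQuadrant (hℓc.mono openQuadrant_subset_closedQuadrant)
      (hR.differentiableOn.add hs')
      fun z hz => hℓ z (openQuadrant_subset_closedQuadrant hz)), fun z hz => ?_⟩
  have hexp : Complex.exp (-ℓ z) = R z - s z := by
    rw [Complex.exp_neg, hℓ z hz]
    exact inv_eq_of_mul_eq_one_right (hinv z hz)
  have hmul : -Complex.I * ℓ z * Complex.I = ℓ z := by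
    linear_combination -ℓ z * Complex.I_mul_I
  rw [Complex.cos, neg_mul, hmul, hℓ z hz, hexp, Pi.add_apply]
  ring

lemma cos_eq_ofReal_of_im_eq_zero {w : ℂ} (hw : w.im = 0) : Complex.cos w = Real.cos w.re := by
  conv_lhs => rw [← Complex.re_add_im w]
  simp [hw]

lemma exists_cos_eq_im_pos {R : ℂ[X]}
    (hR : ∀ z ∈ openQuadrant, ∀ t : ℝ, t ∈ Icc (-1) 1 → R.eval z ≠ t) :
    ∃ φ : ℂ → ℂ, ContinuousOn φ closedQuadrant ∧ DifferentiableOn ℂ φ openQuadrant ∧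
      (∀ z ∈ closedQuadrant, Complex.cos (φ z) = R.eval z) ∧
      ∀ z ∈ openQuadrant, 0 < (φ z).im := by
  have hne : ∀ z ∈ openQuadrant, (R ^ 2 - 1).eval z ≠ 0 := by
    intro z hz hzero
    rw [eval_sub, eval_pow, eval_one, sub_eq_zero, sq, mul_self_eq_one_iff] at hzero
    rcases hzero with h | h
    · exact hR z hz 1 (by norm_num) (by simpa using h)
    · exact hR z hz (-1) (by norm_num) (by simpa using h)
  obtain ⟨s, hs, hs', hsq⟩ := hasQuadrantSqrt_eval hne
  obtain ⟨ψ, hψ, hψ', hcos⟩ := exists_cos_eq_of_sq_eq hs hs' R.differentiable (by simpa using hsq)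
  have him : ∀ z ∈ openQuadrant, (ψ z).im ≠ 0 := fun z hz h =>
    hR z hz _ (Real.cos_mem_Icc _)
      ((hcos z (openQuadrant_subset_closedQuadrant hz)).symm.trans (cos_eq_ofReal_of_im_eq_zero h))
  have hcont : ContinuousOn (fun z => (ψ z).im) openQuadrant :=
    Complex.continuous_im.comp_continuousOn (hψ.mono openQuadrant_subset_closedQuadrant)
  rcases (him _ one_add_I_mem_openQuadrant).lt_or_gt with hneg | hpos
  · refine ⟨fun z => -ψ z, hψ.neg, hψ'.neg, fun z hz => by rw [Complex.cos_neg, hcos z hz],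
      fun z hz => ?_⟩
    exact pos_of_isPreconnected_of_ne_zero isPreconnected_openQuadrant hcont.neg
      (fun w hw => neg_ne_zero.2 (him w hw)) one_add_I_mem_openQuadrant (neg_pos.2 hneg) hz
  · exact ⟨ψ, hψ, hψ', hcos, fun z hz => pos_of_isPreconnected_of_ne_zero
      isPreconnected_openQuadrant hcont him one_add_I_mem_openQuadrant hpos hz⟩

lemma exists_cos_eq_im_pos_map_eq_zero {R : ℂ[X]}
    (hR : ∀ z ∈ openQuadrant, ∀ t : ℝ, t ∈ Icc (-1) 1 → R.eval z ≠ t) {c : ℂ}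
    (hc : c ∈ closedQuadrant) (hRc : R.eval c = 1) :
    ∃ φ : ℂ → ℂ, ContinuousOn φ closedQuadrant ∧ DifferentiableOn ℂ φ openQuadrant ∧
      (∀ z ∈ closedQuadrant, Complex.cos (φ z) = R.eval z) ∧
      (∀ z ∈ openQuadrant, 0 < (φ z).im) ∧ φ c = 0 := by
  obtain ⟨φ, hφ, hφ', hcos, him⟩ := exists_cos_eq_im_pos hR
  obtain ⟨n, hn⟩ := Complex.cos_eq_one_iff.1 ((hcos c hc).trans hRc)
  refine ⟨fun z => φ z - φ c, hφ.sub continuousOn_const, hφ'.sub (differentiableOn_const _),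
    fun z hz => ?_, fun z hz => ?_, sub_self _⟩
  · rw [← hcos z hz, ← hn, Complex.cos_sub_int_mul_two_pi]
  · have hreal : (φ c).im = 0 := by simp [← hn]
    simpa [hreal] using him z hz

lemma tendsto_derivative_div_eval_cobounded (F : ℂ[X]) :
    Tendsto (fun z => F.derivative.eval z / F.eval z) (Bornology.cobounded ℂ) (𝓝 0) := by
  have hterm : ∀ r : ℂ, Tendsto (fun z => 1 / (z - r)) (Bornology.cobounded ℂ) (𝓝 0) := fun r => by
    simpa only [one_div, Function.comp_def] using
      tendsto_inv₀_cobounded.comp (tendsto_sub_const_cobounded r)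
  have hsum : ∀ s : Multiset ℂ, Tendsto (fun z => (s.map fun r => 1 / (z - r)).sum)
      (Bornology.cobounded ℂ) (𝓝 0) := by
    intro s
    simpa using tendsto_multiset_sum s fun r _ => hterm r
  rcases eq_or_ne F 0 with rfl | hF
  · simp
  refine (hsum F.roots).congr' ?_
  filter_upwards [Bornology.le_cofinite ℂ (finite_setOfPred_isRoot hF).compl_mem_cofinite] with z hz
  exact ((IsAlgClosed.splits F).eval_derivative_div_eval_of_ne_zero hz).symm

lemma isBigO_id_of_cos_eq {R : ℂ[X]} (hR : 0 < R.degree) {φ : ℂ → ℂ}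
    (hφ : DifferentiableOn ℂ φ openQuadrant)
    (hcos : ∀ z ∈ openQuadrant, Complex.cos (φ z) = R.eval z) :
    φ =O[Bornology.cobounded ℂ ⊓ 𝓟 openQuadrant] id := by
  have hderiv : ∀ z ∈ openQuadrant, ‖deriv φ z‖ * ‖Complex.sin (φ z)‖ = ‖R.derivative.eval z‖ := by
    intro z hz
    have hnhds := isOpen_openQuadrant.mem_nhds hz
    have heq : (fun w => Complex.cos (φ w)) =ᶠ[𝓝 z] fun w => R.eval w :=
      eventually_of_mem hnhds hcos
    have hd := (hφ.differentiableAt hnhds).hasDerivAt.ccos.congr_of_eventuallyEq heq.symm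
    rw [(R.hasDerivAt z).unique hd, norm_mul, norm_neg, mul_comm]
  refine isBigO_id_of_eventually_norm_deriv_le hφ (K := 2) ?_
  rw [eventually_inf_principal]
  have hlog := (tendsto_derivative_div_eval_cobounded R).norm.eventually_le_const
    (u := 1) (by simp)
  have hlarge := (R.tendsto_norm_atTop hR tendsto_norm_cobounded_atTop).eventually_ge_atTop 2
  filter_upwards [hlog, hlarge] with z hz hz2 hzQ
  have hR' : ‖R.derivative.eval z‖ ≤ ‖R.eval z‖ := by
    rwa [norm_div, div_le_one (by linarith)] at hz
  have hsin : ‖R.eval z‖ / 2 ≤ ‖Complex.sin (φ z)‖ := by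
    have htri := norm_sub_norm_le (Complex.cos (φ z) ^ 2) 1
    rw [show Complex.cos (φ z) ^ 2 - 1 = -Complex.sin (φ z) ^ 2 by
      linear_combination Complex.sin_sq_add_cos_sq (φ z), norm_neg, norm_pow, norm_pow, norm_one,
      hcos z hzQ] at htri
    refine le_of_sq_le_sq ?_ (norm_nonneg _)
    nlinarith
  nlinarith [hderiv z hzQ, norm_nonneg (deriv φ z)]

/-! ### Values omitted in the quadrant -/

lemma isBigO_one_aeval_div_aeval_neg {p S : ℝ[X]} (hdeg : S.natDegree ≤ p.natDegree) :
    (fun z : ℂ => aeval z S / aeval (-z) p) =O[Bornology.cobounded ℂ] fun _ => (1 : ℂ) := by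
  rcases eq_or_ne p 0 with rfl | hp
  · simp only [map_zero, div_zero]
    exact Asymptotics.isBigO_zero _ _
  set q : ℂ[X] := (p.comp (-X)).map (algebraMap ℝ ℂ) with hq
  have hqeval (z : ℂ) : aeval (-z) p = q.eval z := by simp [hq, aeval_comp, eval_map_algebraMap]
  have hqdeg : q.degree = p.natDegree := by
    rw [hq, degree_map, degree_eq_natDegree (by simpa using hp), natDegree_comp, natDegree_neg,
      natDegree_X, mul_one]
  have hle : (S.map (algebraMap ℝ ℂ)).degree ≤ q.degree := by
    rw [hqdeg, degree_map]
    exact degree_le_natDegree.trans (by exact_mod_cast hdeg)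
  obtain ⟨A, hA₀, hA⟩ := (isBigO_cobounded_of_degree_le hle).exists_nonneg
  refine Asymptotics.IsBigO.of_bound A (hA.bound.mono fun z hz => ?_)
  rw [eval_map_algebraMap] at hz
  rw [hqeval, norm_div, norm_one, mul_one]
  exact div_le_of_le_mul₀ (norm_nonneg _) hA₀ hz

/-- On the imaginary axis `p (-z)` is the conjugate of `p z`, so there the quotient is
`p z * S z / ‖p z‖ ^ 2`; on the real axis it is real. -/
lemma im_aeval_div_aeval_neg_neg {p S : ℝ[X]} (hp : ∀ z ∈ closedQuadrant, aeval (-z) p ≠ 0)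
    (hdeg : S.natDegree ≤ p.natDegree)
    (him : ∀ y : ℝ, 0 < y → (aeval (y * Complex.I) (p * S)).im < 0) {z : ℂ}
    (hz : z ∈ openQuadrant) : (aeval z S / aeval (-z) p).im < 0 := by
  set f : ℂ → ℂ := fun z => Complex.I * (aeval z S / aeval (-z) p)
  have hre (w : ℂ) : (f w).re = -(aeval w S / aeval (-w) p).im := Complex.I_mul_re _
  have hdiff (T : ℝ[X]) : Differentiable ℂ fun w : ℂ => aeval w T := T.differentiable_aeval
  have hd : ∀ w ∈ closedQuadrant, DifferentiableAt ℂ f w := fun w hw =>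
    ((hdiff S w).div ((hdiff p).comp differentiable_neg w) (hp w hw)).const_mul _
  have hgrowth : f =O[Bornology.cobounded ℂ ⊓ 𝓟 openQuadrant] id :=
    (((isBigO_one_aeval_div_aeval_neg hdeg).const_mul_left _).trans
      (Asymptotics.isLittleO_const_id_cobounded 1).isBigO).mono inf_le_left
  have hreal : ∀ t : ℝ, (f t).re = 0 := fun t => by
    rw [hre, ← Complex.ofReal_neg, aeval_complex_ofReal, aeval_complex_ofReal, ← Complex.ofReal_div,
      Complex.ofReal_im, neg_zero]
  have himag : ∀ y : ℝ, 0 < y → 0 < (f (y * Complex.I)).re := by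
    intro y hy
    have hconj : aeval (-(y * Complex.I)) p = starRingEnd ℂ (aeval (y * Complex.I) p) := by
      rw [← aeval_conj]; simp
    have hne := hp _ (ofReal_mul_I_mem_closedQuadrant hy.le)
    rw [hconj, _root_.map_ne_zero] at hne
    have hquot : aeval (y * Complex.I) S / aeval (-(y * Complex.I)) p =
        aeval (y * Complex.I) (p * S) / (Complex.normSq (aeval (y * Complex.I) p) : ℝ) := by
      rw [hconj, Complex.normSq_eq_conj_mul_self, map_mul]
      field_simp
    rw [hre, hquot, Complex.div_ofReal_im, neg_pos]
    exact div_neg_of_neg_of_pos (him y hy) (Complex.normSq_pos.2 hne)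
  have hpos := re_pos_of_re_nonneg_on_axes
    (fun w hw => (hd w (openQuadrant_subset_closedQuadrant hw)).differentiableWithinAt)
    (fun w hw => (hd w hw).continuousAt.continuousWithinAt) hgrowth (fun t _ => (hreal t).ge)
    (fun y hy => hy.eq_or_lt.elim (fun h => by simpa [← h] using (hreal 0).ge)
      fun h => (himag y h).le)
    (ofReal_mul_I_mem_closedQuadrant zero_le_one) (himag 1 one_pos) hz
  rwa [hre, neg_pos] at hpos

lemma aeval_ne_zero_of_im_neg {ι : Type*} [Fintype ι] {F : ℝ[X]}
    (hdeg : F.natDegree ≤ 2 * Fintype.card ι) {t : ι → ℝ} (ht : Function.Injective t)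
    (hpos : ∀ j, 0 < t j) (hroot : ∀ j, F.IsRoot (t j))
    (him : ∀ y : ℝ, 0 < y → (aeval (y * Complex.I) F).im < 0) {z : ℂ} (hz : z ∈ openQuadrant) :
    aeval z F ≠ 0 := by
  obtain ⟨S, rfl⟩ : (∏ j, (X - C (t j))) ∣ F := Finset.prod_dvd_of_coprime
    (fun i _ j _ hij => pairwise_coprime_X_sub_C ht hij) fun j _ => dvd_iff_isRoot.2 (hroot j)
  set p : ℝ[X] := ∏ j, (X - C (t j)) with hp
  have hroots (w : ℂ) (hw : aeval w p = 0) : ∃ j, w = t j := by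
    simpa [hp, map_prod, Finset.prod_eq_zero_iff, sub_eq_zero] using hw
  have hpdeg : p.natDegree = Fintype.card ι := by simp [hp, natDegree_prod_of_monic, monic_X_sub_C]
  have hne : p * S ≠ 0 := fun h => by simpa [h] using him 1 one_pos
  have hS : S.natDegree ≤ p.natDegree := by
    rw [natDegree_mul (left_ne_zero_of_mul hne) (right_ne_zero_of_mul hne)] at hdeg
    omega
  have hquot := im_aeval_div_aeval_neg_neg (fun w hw hw₀ => ?_) hS him hz
  · rw [map_mul]
    refine mul_ne_zero (fun h => ?_) fun h => by simp [h] at hquot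
    obtain ⟨j, rfl⟩ := hroots z h
    exact hz.2.ne' (Complex.ofReal_im _)
  · obtain ⟨j, hj⟩ := hroots (-w) hw₀
    have := congrArg Complex.re hj
    rw [Complex.neg_re, Complex.ofReal_re] at this
    linarith [hw.1, hpos j]

lemma isOpen_image_aeval {S : ℝ[X]} (hS : ∀ c, S ≠ C c) {U : Set ℂ} (hU : IsOpen U) :
    IsOpen ((fun z : ℂ => aeval z S) '' U) := by
  have han : AnalyticOnNhd ℂ (fun z : ℂ => aeval z S) univ := fun z _ =>
    (S.differentiable_aeval (𝕜 := ℂ)).analyticAt z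
  rcases han.is_constant_or_isOpen isPreconnected_univ with ⟨c, hc⟩ | hopen
  · refine absurd ?_ (hS c.re)
    refine funext fun t => ?_
    have ht := hc t (mem_univ _)
    rw [aeval_complex_ofReal] at ht
    rw [eval_C, ← ht, Complex.ofReal_re]
  · exact hopen U (subset_univ _) hU

namespace Equioscillates

variable {m : ℕ} {a L : ℝ} {Q : ℝ[X]} {x : Fin (m + 2) → ℝ} (h : Equioscillates m a L Q x)
include h

lemma exists_eval_eq_of_abs_lt {w : ℝ} (hw : |w| < L) (j : Fin (m + 1)) :
    ∃ t ∈ Ioo (x j.castSucc) (x j.succ), (evenError Q).eval t = w := by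
  have hlt := h.strictMono j.castSucc_lt_succ
  have hcont := (evenError Q).continuousOn (s := Icc (x j.castSucc) (x j.succ))
  have hleft := h.eval_node j.castSucc
  have hright := h.eval_node_succ j
  obtain ⟨hw₁, hw₂⟩ := _root_.abs_lt.1 hw
  rw [Fin.val_castSucc] at hleft
  rcases neg_one_pow_eq_or ℝ (j : ℕ) with hj | hj <;> rw [hj] at hleft
  · exact intermediate_value_Ioo' hlt.le hcont ⟨by linarith, by linarith⟩
  · exact intermediate_value_Ioo hlt.le hcont ⟨by linarith, by linarith⟩

lemma aeval_evenError_ne_of_abs_lt {w : ℝ} (hw : |w| < L) {z : ℂ} (hz : z ∈ openQuadrant) :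
    aeval z (evenError Q) ≠ w := by
  choose t ht hroot using h.exists_eval_eq_of_abs_lt hw
  have hmono : StrictMono t := Fin.strictMono_iff_lt_succ.2 fun i =>
    (ht i.castSucc).2.trans (by rw [Fin.succ_castSucc]; exact (ht i.succ).1)
  have hdeg : (evenError Q - C w).natDegree ≤ 2 * Fintype.card (Fin (m + 1)) := by
    have := natDegree_evenError_le Q
    have := h.natDegree_le
    rw [natDegree_sub_C, Fintype.card_fin]
    omega
  have hne := aeval_ne_zero_of_im_neg hdeg hmono.injective
    (fun j => (h.node_pos _).trans (ht j).1) (fun j => by simp [hroot])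
    (fun y hy => by simpa [aeval_evenError_mul_I] using hy) hz
  simpa [sub_eq_zero] using hne

lemma aeval_evenError_ne {w : ℝ} (hw : |w| ≤ L) {z : ℂ} (hz : z ∈ openQuadrant) :
    aeval z (evenError Q) ≠ w := by
  have hdisj : Disjoint ((fun z : ℂ => aeval z (evenError Q)) '' openQuadrant)
      (Complex.ofReal '' Ioo (-L) L) := by
    rw [Set.disjoint_left]
    rintro _ ⟨z, hz, rfl⟩ ⟨w, hw, hwz⟩
    exact h.aeval_evenError_ne_of_abs_lt (_root_.abs_lt.2 hw) hz hwz.symm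
  have hclosure : (w : ℂ) ∈ closure (Complex.ofReal '' Ioo (-L) L) := by
    refine image_closure_subset_closure_image Complex.continuous_ofReal (mem_image_of_mem _ ?_)
    rw [closure_Ioo (by linarith [h.error_pos])]
    exact _root_.abs_le.1 hw
  intro hwz
  exact Set.disjoint_left.1
    (hdisj.closure_right (isOpen_image_aeval (evenError_ne_C Q) isOpen_openQuadrant))
    ⟨z, hz, hwz⟩ hclosure

end Equioscillates

/-! ### The arccosine of the error and its boundary values -/

/-- `φ` is a continuous branch of `arccos (E / L)` on the closed quadrant, holomorphic in the
interior, with values in the upper half plane and `φ a = 0`. -/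
structure IsArccosBranch (a L : ℝ) (E : ℝ[X]) (φ : ℂ → ℂ) : Prop where
  continuousOn : ContinuousOn φ closedQuadrant
  differentiableOn : DifferentiableOn ℂ φ openQuadrant
  aeval_eq : ∀ z ∈ closedQuadrant, aeval z E = L * Complex.cos (φ z)
  im_pos : ∀ z ∈ openQuadrant, 0 < (φ z).im
  map_a : φ a = 0

lemma exists_isArccosBranch {a L : ℝ} {E : ℝ[X]} (ha : 0 ≤ a) (hL : 0 < L)
    (hE : ∀ z ∈ openQuadrant, ∀ w : ℝ, |w| ≤ L → aeval z E ≠ w) (hEa : E.eval a = L) :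
    ∃ φ, IsArccosBranch a L E φ := by
  have hL' : (L : ℂ) ≠ 0 := by exact_mod_cast hL.ne'
  have heval (z : ℂ) : (C (L : ℂ)⁻¹ * E.map (algebraMap ℝ ℂ)).eval z = (L : ℂ)⁻¹ * aeval z E := by
    rw [eval_mul, eval_C, eval_map_algebraMap]
  have homits : ∀ z ∈ openQuadrant, ∀ t : ℝ, t ∈ Icc (-1) 1 →
      (C (L : ℂ)⁻¹ * E.map (algebraMap ℝ ℂ)).eval z ≠ t := by
    intro z hz t ht heq
    rw [heval, inv_mul_eq_iff_eq_mul₀ hL', ← Complex.ofReal_mul] at heq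
    refine hE z hz _ ?_ heq
    rw [abs_mul, abs_of_pos hL]
    exact mul_le_of_le_one_right hL.le (abs_le.2 ht)
  obtain ⟨φ, hc, hd, hcos, him, ha⟩ := exists_cos_eq_im_pos_map_eq_zero homits
    (ofReal_mem_closedQuadrant ha) (by rw [heval, aeval_complex_ofReal, hEa, inv_mul_cancel₀ hL'])
  exact ⟨φ, hc, hd, fun z hz => by rw [hcos z hz, heval, mul_inv_cancel_left₀ hL'], him, ha⟩

lemma re_cos (w : ℂ) : (Complex.cos w).re = Real.cos w.re * Real.cosh w.im := by
  rw [Complex.cos_eq]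
  simp [← Complex.ofReal_cos, ← Complex.ofReal_cosh, ← Complex.ofReal_sin, ← Complex.ofReal_sinh]

lemma im_cos (w : ℂ) : (Complex.cos w).im = -(Real.sin w.re * Real.sinh w.im) := by
  rw [Complex.cos_eq]
  simp [← Complex.ofReal_cos, ← Complex.ofReal_cosh, ← Complex.ofReal_sin, ← Complex.ofReal_sinh]

lemma eq_of_sin_eq_zero {θ : ℝ → ℝ} {s : Set ℝ} (hs : IsPreconnected s) (hθ : ContinuousOn θ s)
    (hsin : ∀ t ∈ s, Real.sin (θ t) = 0) {t t' : ℝ} (ht : t ∈ s) (ht' : t' ∈ s) : θ t = θ t' := by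
  refine hs.constant_of_mapsTo (T := (AddSubgroup.zmultiples Real.pi : Set ℝ))
    ⟨NormedSpace.discreteTopology_zmultiples _⟩ hθ (fun t ht => ?_) ht ht'
  obtain ⟨n, hn⟩ := Real.sin_eq_zero_iff.1 (hsin t ht)
  exact ⟨n, by simp [hn]⟩

/-- The difference of the two sides has vanishing sine. -/
lemma eq_arccos_cos_of_sin_nonneg {θ : ℝ → ℝ} {s : Set ℝ} (hs : IsPreconnected s)
    (hθ : ContinuousOn θ s) (hsin : ∀ t ∈ s, 0 ≤ Real.sin (θ t)) {c : ℝ} (hc : c ∈ s)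
    (hθc : θ c = 0) {t : ℝ} (ht : t ∈ s) : θ t = Real.arccos (Real.cos (θ t)) := by
  have hcont : ContinuousOn (fun t => θ t - Real.arccos (Real.cos (θ t))) s :=
    hθ.sub (Real.continuous_arccos.comp Real.continuous_cos |>.comp_continuousOn hθ)
  have hconst := eq_of_sin_eq_zero hs hcont (fun r hr => ?_) ht hc
  · simpa [hθc, sub_eq_zero] using hconst
  · rw [Real.sin_sub, Real.cos_arccos (Real.neg_one_le_cos _) (Real.cos_le_one _),
      Real.sin_arccos, ← Real.abs_sin_eq_sqrt_one_sub_cos_sq, abs_of_nonneg (hsin r hr)]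
    ring

lemma eventually_im_aeval_pos {p : ℝ[X]} {t : ℝ} (hp : 0 < (derivative p).eval t) :
    ∀ᶠ ε : ℝ in 𝓝[>] 0, 0 < (aeval (t + ε * Complex.I) p).im := by
  have hline : HasDerivAt (fun ε : ℝ => (t : ℂ) + ε * Complex.I) Complex.I 0 := by
    simpa using (Complex.ofRealCLM.hasDerivAt.mul_const Complex.I).const_add (t : ℂ)
  have hderiv : HasDerivAt (fun ε : ℝ => (aeval (t + ε * Complex.I) p).im)
      ((derivative p).eval t) 0 := by
    refine (Complex.imCLM.hasFDerivAt.comp_hasDerivAt (0 : ℝ)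
      ((p.hasDerivAt_aeval _).comp (0 : ℝ) hline)).congr_deriv ?_
    simp [aeval_complex_ofReal]
  have hsign := eventually_nhdsWithin_sign_eq_of_deriv_pos (hderiv.deriv.symm ▸ hp)
    (by simp [aeval_complex_ofReal])
  filter_upwards [nhdsWithin_le_nhds hsign, self_mem_nhdsWithin] with ε hε hε₀
  rw [sub_zero, sign_pos (show (0 : ℝ) < ε from hε₀)] at hε
  exact sign_eq_one_iff.1 hε

namespace IsArccosBranch

variable {a L : ℝ} {E : ℝ[X]} {φ : ℂ → ℂ} (b : IsArccosBranch a L E φ)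
include b

lemma im_nonneg {z : ℂ} (hz : z ∈ closedQuadrant) : 0 ≤ (φ z).im := by
  have hmaps : MapsTo (fun w => (φ w).im) (closure openQuadrant) (closure (Ioi 0)) :=
    MapsTo.closure_of_continuousOn b.im_pos (by
      rw [closure_openQuadrant]
      exact Complex.continuous_im.comp_continuousOn b.continuousOn)
  rw [closure_Ioi, closure_openQuadrant] at hmaps
  exact hmaps hz

lemma re_aeval {z : ℂ} (hz : z ∈ closedQuadrant) :
    (aeval z E).re = L * (Real.cos (φ z).re * Real.cosh (φ z).im) := by
  rw [b.aeval_eq z hz, Complex.re_ofReal_mul, re_cos]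

lemma im_aeval {z : ℂ} (hz : z ∈ closedQuadrant) :
    (aeval z E).im = -(L * (Real.sin (φ z).re * Real.sinh (φ z).im)) := by
  rw [b.aeval_eq z hz, Complex.im_ofReal_mul, im_cos, mul_neg]

lemma eval_eq {t : ℝ} (ht : 0 ≤ t) :
    E.eval t = L * (Real.cos (φ t).re * Real.cosh (φ t).im) := by
  rw [← b.re_aeval (ofReal_mem_closedQuadrant ht), aeval_complex_ofReal, Complex.ofReal_re]

lemma sin_eq_zero_or_im_eq_zero (hL : L ≠ 0) {t : ℝ} (ht : 0 ≤ t) :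
    Real.sin (φ t).re = 0 ∨ (φ t).im = 0 := by
  simpa [aeval_complex_ofReal, hL] using b.im_aeval (ofReal_mem_closedQuadrant ht)

lemma im_pos_of_lt_abs (hL : 0 < L) {t : ℝ} (ht : 0 ≤ t) (hlt : L < |E.eval t|) :
    0 < (φ t).im := by
  refine (b.im_nonneg (ofReal_mem_closedQuadrant ht)).lt_of_ne' fun him => hlt.not_ge ?_
  rw [b.eval_eq ht, him, Real.cosh_zero, mul_one, abs_mul, abs_of_pos hL]
  exact mul_le_of_le_one_right hL.le (Real.abs_cos_le_one _)

lemma sin_eq_zero_of_le_abs (hL : 0 < L) {t : ℝ} (ht : 0 ≤ t) (hle : L ≤ |E.eval t|) :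
    Real.sin (φ t).re = 0 := by
  refine (b.sin_eq_zero_or_im_eq_zero hL.ne' ht).elim id fun him => ?_
  rw [b.eval_eq ht, him, Real.cosh_zero, mul_one, abs_mul, abs_of_pos hL] at hle
  have hcos : 1 ≤ |Real.cos (φ t).re| := le_of_mul_le_mul_left (by rwa [mul_one]) hL
  nlinarith [Real.sin_sq_add_cos_sq (φ t).re, sq_abs (Real.cos (φ t).re),
    sq_nonneg (Real.sin (φ t).re)]

lemma im_eq_zero_of_abs_le (hL : 0 < L) {t : ℝ} (ht : 0 ≤ t) (hle : |E.eval t| ≤ L) :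
    (φ t).im = 0 := by
  by_contra him
  have hsin := (b.sin_eq_zero_or_im_eq_zero hL.ne' ht).resolve_right him
  have hcos : |Real.cos (φ t).re| = 1 := by
    rw [Real.abs_cos_eq_sqrt_one_sub_sin_sq, hsin]
    simp
  rw [b.eval_eq ht, abs_mul, abs_mul, hcos, abs_of_pos hL, one_mul,
    abs_of_pos (Real.cosh_pos _)] at hle
  exact hle.not_gt (lt_mul_of_one_lt_right hL (Real.one_lt_cosh.2 him))

lemma eval_eq_of_abs_le (hL : 0 < L) {t : ℝ} (ht : 0 ≤ t) (hle : |E.eval t| ≤ L) :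
    E.eval t = L * Real.cos (φ t).re := by
  rw [b.eval_eq ht, b.im_eq_zero_of_abs_le hL ht hle, Real.cosh_zero, mul_one]

lemma continuousOn_ofReal : ContinuousOn (fun t : ℝ => φ t) (Ici 0) :=
  b.continuousOn.comp Complex.continuous_ofReal.continuousOn fun _ => ofReal_mem_closedQuadrant

lemma continuousOn_ofReal_mul_I : ContinuousOn (fun y : ℝ => φ (y * Complex.I)) (Ici 0) :=
  b.continuousOn.comp (by fun_prop) fun _ => ofReal_mul_I_mem_closedQuadrant

lemma continuousOn_re_ofReal : ContinuousOn (fun t : ℝ => (φ t).re) (Ici 0) :=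
  Complex.continuous_re.comp_continuousOn b.continuousOn_ofReal

lemma continuousOn_im_ofReal : ContinuousOn (fun t : ℝ => (φ t).im) (Ici 0) :=
  Complex.continuous_im.comp_continuousOn b.continuousOn_ofReal

lemma continuousOn_re_ofReal_mul_I : ContinuousOn (fun y : ℝ => (φ (y * Complex.I)).re) (Ici 0) :=
  Complex.continuous_re.comp_continuousOn b.continuousOn_ofReal_mul_I

lemma re_eq_of_le_abs (hL : 0 < L) {s : Set ℝ} (hs : IsPreconnected s)
    (hle : ∀ t ∈ s, 0 ≤ t ∧ L ≤ |E.eval t|) {t t' : ℝ} (ht : t ∈ s) (ht' : t' ∈ s) :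
    (φ t).re = (φ t').re :=
  eq_of_sin_eq_zero hs (b.continuousOn_re_ofReal.mono fun r hr => (hle r hr).1)
    (fun r hr => b.sin_eq_zero_of_le_abs hL (hle r hr).1 (hle r hr).2) ht ht'

/-- Just above the real axis `Im E` has the sign of `E'`, and `Im E = -L sin u sinh v`. -/
lemma mul_sin_re_nonneg_of_derivative_neg (hL : 0 < L) {σ t : ℝ} (ht : 0 < t)
    (hneg : σ * (derivative E).eval t < 0) : 0 ≤ σ * Real.sin (φ t).re := by
  have hmem : ∀ ε : ℝ, 0 ≤ ε → (t : ℂ) + ε * Complex.I ∈ closedQuadrant := fun ε hε => by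
    simp [closedQuadrant, ht.le, hε]
  have hcont : ContinuousOn (fun ε : ℝ => σ * Real.sin (φ (t + ε * Complex.I)).re) (Ici 0) :=
    continuousOn_const.mul (Real.continuous_sin.comp_continuousOn
      (Complex.continuous_re.comp_continuousOn (b.continuousOn.comp (by fun_prop) hmem)))
  have hlim := (hcont 0 self_mem_Ici).tendsto.mono_left (nhdsWithin_mono _ Ioi_subset_Ici_self)
  rw [Complex.ofReal_zero, zero_mul, add_zero] at hlim
  refine ge_of_tendsto hlim ?_
  have hev := eventually_im_aeval_pos (p := -(C σ * E)) (t := t) (by simpa using hneg)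
  filter_upwards [hev, self_mem_nhdsWithin] with ε him hε
  have hv := b.im_pos (t + ε * Complex.I) (by simpa [openQuadrant, ht] using hε)
  have hpos : 0 < (σ * Real.sin (φ (t + ε * Complex.I)).re) *
      (L * Real.sinh (φ (t + ε * Complex.I)).im) := by
    rw [map_neg, map_mul, aeval_C, Complex.neg_im, Complex.coe_algebraMap, Complex.im_ofReal_mul,
      b.im_aeval (hmem ε (le_of_lt hε))] at him
    linarith
  exact ((mul_pos_iff_of_pos_right (mul_pos hL (Real.sinh_pos_iff.2 hv))).1 hpos).le

end IsArccosBranch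

/-! ### The boundary values on the real axis -/

namespace Equioscillates

variable {m : ℕ} {a L : ℝ} {Q : ℝ[X]} {x : Fin (m + 2) → ℝ} (h : Equioscillates m a L Q x)
include h

lemma antitoneOn_between (j : Fin (m + 1)) :
    AntitoneOn (fun t => (-1) ^ (j : ℕ) * (evenError Q).eval t)
      (Icc (x j.castSucc) (x j.succ)) := by
  refine antitoneOn_of_deriv_nonpos (convex_Icc _ _) (by fun_prop) (by fun_prop) fun t ht => ?_
  rw [interior_Icc] at ht
  rw [(((evenError Q).hasDerivAt t).const_mul _).deriv]
  have hsign := h.derivative_sign_between j ht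
  rw [pow_succ] at hsign
  linarith

lemma le_eval_left {t : ℝ} (ht : t ∈ Icc 0 a) : L ≤ (evenError Q).eval t := by
  have ha : a ≤ x 1 := (h.node_mem 1).1
  rw [← h.eval_left_endpoint]
  exact h.strictAntiOn_left.antitoneOn ⟨ht.1, ht.2.trans ha⟩ ⟨h.pos.le, ha⟩ ht.2

lemma le_abs_eval_right {t : ℝ} (ht : 1 ≤ t) : L ≤ |(evenError Q).eval t| := by
  have hmono : MonotoneOn (fun t => (-1) ^ (m + 1) * (evenError Q).eval t) (Ici 1) := by
    refine monotoneOn_of_deriv_nonneg (convex_Ici _) (by fun_prop) (by fun_prop) fun s hs => ?_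
    rw [interior_Ici] at hs
    rw [(((evenError Q).hasDerivAt s).const_mul _).deriv]
    exact (h.derivative_sign_right (le_of_lt hs)).le
  have hle := hmono self_mem_Ici (mem_Ici.2 ht) ht
  have hone := h.eval_node (Fin.last _)
  rw [h.node_last, Fin.val_last] at hone
  simp only [hone, ← mul_assoc, ← mul_pow] at hle
  norm_num at hle
  exact hle.trans ((le_abs_self _).trans_eq (by rw [abs_mul, abs_neg_one_pow, one_mul]))

end Equioscillates

namespace IsArccosBranch

variable {m : ℕ} {a L : ℝ} {Q : ℝ[X]} {x : Fin (m + 2) → ℝ} {φ : ℂ → ℂ}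
  (b : IsArccosBranch a L (evenError Q) φ) (h : Equioscillates m a L Q x)
include b h

lemma re_eq_zero_left {t : ℝ} (ht : t ∈ Icc 0 a) : (φ t).re = 0 := by
  rw [b.re_eq_of_le_abs h.error_pos isPreconnected_Icc
    (fun s hs => ⟨hs.1, (h.le_eval_left hs).trans (le_abs_self _)⟩) ht ⟨h.pos.le, le_rfl⟩,
    b.map_a, Complex.zero_re]

lemma mul_sin_re_nonneg_between (j : Fin (m + 1)) {t : ℝ}
    (ht : t ∈ Icc (x j.castSucc) (x j.succ)) : 0 ≤ (-1) ^ (j : ℕ) * Real.sin (φ t).re := by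
  have hnode (k : Fin (m + 2)) : Real.sin (φ (x k)).re = 0 :=
    b.sin_eq_zero_of_le_abs h.error_pos (h.node_pos k).le (h.abs_node k).ge
  rcases ht.1.eq_or_lt with rfl | hl
  · rw [hnode, mul_zero]
  rcases ht.2.eq_or_lt with rfl | hr
  · rw [hnode, mul_zero]
  refine b.mul_sin_re_nonneg_of_derivative_neg h.error_pos ((h.node_pos _).trans hl) ?_
  have hsign := h.derivative_sign_between j ⟨hl, hr⟩
  rw [pow_succ] at hsign
  linarith

lemma re_eq_between (j : Fin (m + 1)) (hj : (φ (x j.castSucc)).re = j * Real.pi) {t : ℝ}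
    (ht : t ∈ Icc (x j.castSucc) (x j.succ)) :
    (φ t).re = j * Real.pi + Real.arccos ((-1) ^ (j : ℕ) * (evenError Q).eval t / L) := by
  have hpos : Icc (x j.castSucc) (x j.succ) ⊆ Ici 0 := fun s hs => (h.node_pos _).le.trans hs.1
  have heq := eq_arccos_cos_of_sin_nonneg (θ := fun s => (φ s).re - j * Real.pi)
    isPreconnected_Icc ((b.continuousOn_re_ofReal.mono hpos).sub continuousOn_const)
    (fun s hs => by
      rw [Real.sin_sub_nat_mul_pi]
      exact b.mul_sin_re_nonneg_between h j hs)
    ⟨le_rfl, (h.strictMono Fin.castSucc_lt_succ).le⟩ (by simp [hj]) ht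
  have hmem : t ∈ Icc a 1 := ⟨(h.node_mem _).1.trans ht.1, ht.2.trans (h.node_mem _).2⟩
  rw [Real.cos_sub_nat_mul_pi] at heq
  rw [b.eval_eq_of_abs_le h.error_pos (hpos ht) (h.abs_le t hmem), mul_left_comm,
    mul_div_cancel_left₀ _ h.error_pos.ne']
  linarith

lemma re_node (j : Fin (m + 2)) : (φ (x j)).re = j * Real.pi := by
  induction j using Fin.induction with
  | zero => simp [h.node_zero, b.map_a]
  | succ j ih =>
    rw [b.re_eq_between h j ih ⟨(h.strictMono Fin.castSucc_lt_succ).le, le_rfl⟩, h.eval_node_succ,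
      h.eval_node, Fin.val_castSucc, mul_neg, ← mul_assoc, ← mul_pow, neg_div]
    norm_num [h.error_pos.ne']
    ring

lemma monotoneOn_re_between (j : Fin (m + 1)) :
    MonotoneOn (fun t : ℝ => (φ t).re) (Icc (x j.castSucc) (x j.succ)) := by
  intro s hs t ht hst
  simp only [b.re_eq_between h j (b.re_node h j.castSucc) hs,
    b.re_eq_between h j (b.re_node h j.castSucc) ht]
  exact add_le_add_right (Real.antitone_arccos
    (div_le_div_of_nonneg_right (h.antitoneOn_between j hs ht hst) h.error_pos.le)) _

lemma monotoneOn_re_Icc_node (j : Fin (m + 2)) :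
    MonotoneOn (fun t : ℝ => (φ t).re) (Icc 0 (x j)) := by
  induction j using Fin.induction with
  | zero =>
    rw [h.node_zero]
    intro s hs t ht _
    simp only [b.re_eq_zero_left h hs, b.re_eq_zero_left h ht, le_refl]
  | succ j ih =>
    have hle := (h.strictMono (Fin.castSucc_lt_succ (i := j))).le
    have h₀ := (h.node_pos j.castSucc).le
    rw [← Icc_union_Icc_eq_Icc h₀ hle]
    exact ih.union_right (b.monotoneOn_re_between h j) (isGreatest_Icc h₀) (isLeast_Icc hle)

lemma re_eq_right {t : ℝ} (ht : 1 ≤ t) : (φ t).re = (m + 1) * Real.pi := by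
  have hlast := b.re_node h (Fin.last _)
  rw [h.node_last, Fin.val_last, Nat.cast_succ] at hlast
  rw [← hlast]
  exact b.re_eq_of_le_abs h.error_pos isPreconnected_Ici
    (fun s hs => ⟨zero_le_one.trans hs, h.le_abs_eval_right hs⟩) ht self_mem_Ici

lemma monotoneOn_re_ofReal : MonotoneOn (fun t : ℝ => (φ t).re) (Ici 0) := by
  have hleft := b.monotoneOn_re_Icc_node h (Fin.last _)
  rw [h.node_last] at hleft
  have hright : MonotoneOn (fun t : ℝ => (φ t).re) (Ici 1) := fun s hs t ht _ => by
    simp only [b.re_eq_right h hs, b.re_eq_right h ht, le_refl]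
  rw [← Icc_union_Ici_eq_Ici (zero_le_one' ℝ)]
  exact hleft.union_right hright (isGreatest_Icc zero_le_one) isLeast_Ici

lemma re_ofReal_mem_Icc {t : ℝ} (ht : 0 ≤ t) : (φ t).re ∈ Icc 0 ((m + 1) * Real.pi) := by
  constructor
  · rw [← b.re_eq_zero_left h ⟨le_rfl, h.pos.le⟩]
    exact b.monotoneOn_re_ofReal h self_mem_Ici ht ht
  · rw [← b.re_eq_right h (le_max_right t 1)]
    exact b.monotoneOn_re_ofReal h ht (mem_Ici.2 (ht.trans (le_max_left _ _))) (le_max_left t 1)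

end IsArccosBranch

/-! ### The boundary values on the imaginary axis -/

lemma sin_mul_sinh_lt_of_cos_nonneg {u₁ u₂ v₁ v₂ : ℝ} (hu₂ : 0 < u₂) (hu : u₂ ≤ u₁)
    (hu₁ : u₁ < Real.pi) (hv₁ : 0 ≤ v₁) (hv₂ : 0 ≤ v₂) (hcos₂ : 0 ≤ Real.cos u₂)
    (hlt : Real.cos u₂ * Real.cosh v₂ < Real.cos u₁ * Real.cosh v₁) :
    Real.sin u₂ * Real.sinh v₂ < Real.sin u₁ * Real.sinh v₁ := by
  have hcos : Real.cos u₁ ≤ Real.cos u₂ := Real.cos_le_cos_of_nonneg_of_le_pi hu₂.le hu₁.le hu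
  have hcos₁ : 0 < Real.cos u₁ := (mul_pos_iff_of_pos_right (Real.cosh_pos v₁)).1
    ((mul_nonneg hcos₂ (Real.cosh_pos v₂).le).trans_lt hlt)
  have hright : u₁ ≤ Real.pi / 2 := by
    by_contra! hgt
    exact hcos₁.not_ge (Real.cos_nonpos_of_pi_div_two_le_of_le hgt.le (by linarith))
  have hsin : Real.sin u₂ ≤ Real.sin u₁ :=
    Real.sin_le_sin_of_le_of_le_pi_div_two (by linarith [Real.pi_pos]) hright hu
  have hcosh : Real.cosh v₂ < Real.cosh v₁ := by
    by_contra! hle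
    exact hlt.not_ge (mul_le_mul hcos hle (Real.cosh_pos _).le hcos₂)
  rw [Real.cosh_lt_cosh, abs_of_nonneg hv₁, abs_of_nonneg hv₂] at hcosh
  exact mul_lt_mul_of_le_of_lt_of_pos_of_nonneg hsin (Real.sinh_lt_sinh.2 hcosh)
    (Real.sin_pos_of_pos_of_lt_pi hu₂ (hu.trans_lt hu₁)) (Real.sinh_nonneg_iff.2 hv₁)

lemma cos_mul_cosh_mul_le_of_cos_neg {u₁ u₂ v₁ v₂ : ℝ} (hu₂ : 0 < u₂) (hu : u₂ ≤ u₁)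
    (hu₁ : u₁ < Real.pi) (hv₁ : 0 ≤ v₁) (hv₂ : 0 ≤ v₂) (hcos₂ : Real.cos u₂ < 0)
    (hlt : Real.cos u₂ * Real.cosh v₂ < Real.cos u₁ * Real.cosh v₁) :
    Real.cos u₁ * Real.cosh v₁ * (Real.sin u₂ * Real.sinh v₂) ≤
      Real.cos u₂ * Real.cosh v₂ * (Real.sin u₁ * Real.sinh v₁) := by
  have hcos : Real.cos u₁ ≤ Real.cos u₂ := Real.cos_le_cos_of_nonneg_of_le_pi hu₂.le hu₁.le hu
  have hleft : Real.pi / 2 ≤ u₂ := by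
    by_contra! hgt
    exact hcos₂.not_ge (Real.cos_nonneg_of_neg_pi_div_two_le_of_le (by linarith) hgt.le)
  have hsin : Real.sin u₁ ≤ Real.sin u₂ := by
    rw [← Real.sin_pi_sub, ← Real.sin_pi_sub u₂]
    exact Real.sin_le_sin_of_le_of_le_pi_div_two (by linarith) (by linarith) (by linarith)
  have hcosh : Real.cosh v₁ < Real.cosh v₂ := by
    by_contra! hle
    refine hlt.not_ge ((mul_le_mul_of_nonneg_right hcos (Real.cosh_pos _).le).trans ?_)
    exact mul_le_mul_of_nonpos_left hle hcos₂.le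
  rw [Real.cosh_lt_cosh, abs_of_nonneg hv₁, abs_of_nonneg hv₂] at hcosh
  have htanh : Real.cosh v₂ * Real.sinh v₁ ≤ Real.cosh v₁ * Real.sinh v₂ := by
    have hsinh := Real.sinh_nonneg_iff.2 (sub_nonneg.2 hcosh.le)
    rw [Real.sinh_sub] at hsinh
    linarith
  have hcos_sin : -Real.cos u₂ * Real.sin u₁ ≤ -Real.cos u₁ * Real.sin u₂ :=
    mul_le_mul (neg_le_neg hcos) hsin (Real.sin_nonneg_of_nonneg_of_le_pi (by linarith) hu₁.le)
      (by linarith)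
  have hsinh₁ := Real.sinh_nonneg_iff.2 hv₁
  have hsin₂ := Real.sin_nonneg_of_nonneg_of_le_pi hu₂.le (hu.trans hu₁.le)
  have hprod := mul_le_mul hcos_sin htanh (mul_nonneg (Real.cosh_pos _).le hsinh₁)
    (mul_nonneg (by linarith) hsin₂)
  linarith

lemma lt_of_cos_mul_cosh_lt {u₁ u₂ v₁ v₂ : ℝ} (hu₁ : u₁ < Real.pi) (hu₂ : 0 < u₂)
    (hv₁ : 0 ≤ v₁) (hv₂ : 0 ≤ v₂)
    (hcos : Real.cos u₂ * Real.cosh v₂ < Real.cos u₁ * Real.cosh v₁)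
    (hsin : Real.sin u₁ * Real.sinh v₁ ≤ Real.sin u₂ * Real.sinh v₂)
    (hslope : Real.cos u₂ * Real.cosh v₂ * (Real.sin u₁ * Real.sinh v₁) <
      Real.cos u₁ * Real.cosh v₁ * (Real.sin u₂ * Real.sinh v₂)) : u₁ < u₂ := by
  by_contra! hu
  rcases le_or_gt 0 (Real.cos u₂) with hcos₂ | hcos₂
  · exact (sin_mul_sinh_lt_of_cos_nonneg hu₂ hu hu₁ hv₁ hv₂ hcos₂ hcos).not_ge hsin
  · exact (cos_mul_cosh_mul_le_of_cos_neg hu₂ hu hu₁ hv₁ hv₂ hcos₂ hcos).not_gt hslope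

namespace Equioscillates

variable {m : ℕ} {a L : ℝ} {Q : ℝ[X]} {x : Fin (m + 2) → ℝ} (h : Equioscillates m a L Q x)
include h

lemma eval_zero_pos : 0 < Q.eval 0 := by
  have hle := h.le_eval_left ⟨le_rfl, h.pos.le⟩
  rw [eval_evenError] at hle
  simpa using h.error_pos.trans_le hle

lemma strictMonoOn_eval_Iic : StrictMonoOn Q.eval (Iic 0) := by
  refine strictMonoOn_of_deriv_pos (convex_Iic _) Q.continuous.continuousOn fun t ht => ?_
  rw [interior_Iic] at ht
  rw [Polynomial.deriv]
  exact h.derivative_pos (le_of_lt ht)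

lemma antitoneOn_eval_derivative_Iic : AntitoneOn (derivative Q).eval (Iic 0) := by
  refine antitoneOn_of_deriv_nonpos (convex_Iic _) (derivative Q).continuous.continuousOn
    (derivative Q).differentiable.differentiableOn fun t ht => ?_
  rw [interior_Iic] at ht
  rw [Polynomial.deriv]
  exact h.derivative_derivative_nonpos (le_of_lt ht)

lemma strictAntiOn_eval_neg_sq : StrictAntiOn (fun y => Q.eval (-y ^ 2)) (Ici 0) := by
  intro s hs t _ hst
  refine h.strictMonoOn_eval_Iic (mem_Iic.2 ?_) (mem_Iic.2 ?_)
    (neg_lt_neg (pow_lt_pow_left₀ hst hs two_ne_zero)) <;> simp [sq_nonneg]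

lemma concaveOn_eval_neg_sq : ConcaveOn ℝ (Ici 0) (fun y => Q.eval (-y ^ 2)) := by
  have hderiv (y : ℝ) :
      HasDerivAt (fun y => Q.eval (-y ^ 2)) (-(2 * y * (derivative Q).eval (-y ^ 2))) y := by
    have hcomp := (Q.hasDerivAt (-y ^ 2)).comp y (hasDerivAt_pow 2 y).fun_neg
    exact hcomp.congr_deriv (by push_cast; ring)
  refine AntitoneOn.concaveOn_of_deriv (convex_Ici _)
    (fun y _ => (hderiv y).continuousAt.continuousWithinAt)
    (fun y _ => (hderiv y).differentiableAt.differentiableWithinAt) ?_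
  rw [interior_Ici]
  intro s hs t ht hst
  rw [(hderiv s).deriv, (hderiv t).deriv]
  have hnonpos (y : ℝ) : -y ^ 2 ≤ 0 := by simp [sq_nonneg]
  have hanti : (derivative Q).eval (-s ^ 2) ≤ (derivative Q).eval (-t ^ 2) :=
    h.antitoneOn_eval_derivative_Iic (hnonpos t) (hnonpos s)
      (neg_le_neg (pow_le_pow_left₀ (le_of_lt hs) hst 2))
  exact neg_le_neg (mul_le_mul (by linarith) hanti (h.derivative_pos (hnonpos s)).le
    (mul_nonneg zero_le_two (le_of_lt ht)))

lemma mul_eval_neg_sq_lt {y₁ y₂ : ℝ} (hy₁ : 0 < y₁) (hy : y₁ < y₂) :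
    y₁ * Q.eval (-y₂ ^ 2) < y₂ * Q.eval (-y₁ ^ 2) := by
  have hy₂ : 0 < y₂ := hy₁.trans hy
  have hconc := h.concaveOn_eval_neg_sq.2 self_mem_Ici (mem_Ici.2 hy₂.le)
    (sub_nonneg.2 ((div_le_one hy₂).2 hy.le)) (div_pos hy₁ hy₂).le (sub_add_cancel _ _)
  simp only [smul_eq_mul, mul_zero, zero_add, div_mul_cancel₀ _ hy₂.ne'] at hconc
  have hzero : 0 < (1 - y₁ / y₂) * Q.eval (-0 ^ 2) :=
    mul_pos (sub_pos.2 ((div_lt_one hy₂).2 hy)) (by simpa using h.eval_zero_pos)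
  have hlt : y₁ / y₂ * Q.eval (-y₂ ^ 2) < Q.eval (-y₁ ^ 2) := by linarith
  rwa [div_mul_eq_mul_div, div_lt_iff₀ hy₂, mul_comm (Q.eval _) y₂] at hlt

end Equioscillates

namespace IsArccosBranch

variable {m : ℕ} {a L : ℝ} {Q : ℝ[X]} {x : Fin (m + 2) → ℝ} {φ : ℂ → ℂ}

section

variable (b : IsArccosBranch a L (evenError Q) φ)
include b

lemma eval_neg_sq_eq {y : ℝ} (hy : 0 ≤ y) : Q.eval (-y ^ 2) =
    L * (Real.cos (φ (y * Complex.I)).re * Real.cosh (φ (y * Complex.I)).im) := by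
  rw [← b.re_aeval (ofReal_mul_I_mem_closedQuadrant hy), aeval_evenError_mul_I]
  simp

lemma mul_sin_mul_sinh {y : ℝ} (hy : 0 ≤ y) :
    L * (Real.sin (φ (y * Complex.I)).re * Real.sinh (φ (y * Complex.I)).im) = y := by
  have him := b.im_aeval (ofReal_mul_I_mem_closedQuadrant hy)
  rw [aeval_evenError_mul_I] at him
  simpa using him.symm

lemma im_ofReal_mul_I_pos {y : ℝ} (hy : 0 < y) : 0 < (φ (y * Complex.I)).im := by
  refine (b.im_nonneg (ofReal_mul_I_mem_closedQuadrant hy.le)).lt_of_ne' fun him => hy.ne ?_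
  rw [← b.mul_sin_mul_sinh hy.le, him, Real.sinh_zero, mul_zero, mul_zero]

lemma sin_re_ofReal_mul_I_pos (hL : 0 < L) {y : ℝ} (hy : 0 < y) :
    0 < Real.sin (φ (y * Complex.I)).re := by
  have hpos := hy
  rw [← b.mul_sin_mul_sinh hy.le, mul_pos_iff_of_pos_left hL] at hpos
  exact (mul_pos_iff_of_pos_right (Real.sinh_pos_iff.2 (b.im_ofReal_mul_I_pos hy))).1 hpos

end

variable (b : IsArccosBranch a L (evenError Q) φ) (h : Equioscillates m a L Q x)
include b h

lemma map_zero_re : (φ 0).re = 0 := by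
  simpa using b.re_eq_zero_left h ⟨le_rfl, h.pos.le⟩

lemma map_zero_im_pos : 0 < (φ 0).im := by
  have hlt : L < (evenError Q).eval 0 := by
    rw [← h.eval_left_endpoint]
    have ha := (h.node_mem 1).1
    exact h.strictAntiOn_left ⟨le_rfl, h.pos.le.trans ha⟩ ⟨h.pos.le, ha⟩ h.pos
  simpa using b.im_pos_of_lt_abs h.error_pos le_rfl (hlt.trans_le (le_abs_self _))

lemma re_ofReal_mul_I_mem_Ioo {y : ℝ} (hy : 0 < y) :
    (φ (y * Complex.I)).re ∈ Ioo 0 Real.pi := by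
  have hsin := b.sin_re_ofReal_mul_I_pos h.error_pos hy
  have heq := eq_arccos_cos_of_sin_nonneg (θ := fun y : ℝ => (φ (y * Complex.I)).re)
    isPreconnected_Ici b.continuousOn_re_ofReal_mul_I (fun t ht => ?_) self_mem_Ici
    (by simpa using b.map_zero_re h) (mem_Ici.2 hy.le)
  · constructor
    · refine (heq ▸ Real.arccos_nonneg _).lt_of_ne' fun h₀ => ?_
      simp [h₀] at hsin
    · refine (heq ▸ Real.arccos_le_pi _).lt_of_ne fun hpi => ?_
      simp [hpi] at hsin
  · rcases (mem_Ici.1 ht).eq_or_lt with rfl | ht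
    · simp [b.map_zero_re h]
    · exact (b.sin_re_ofReal_mul_I_pos h.error_pos ht).le

lemma strictMonoOn_re_ofReal_mul_I :
    StrictMonoOn (fun y : ℝ => (φ (y * Complex.I)).re) (Ioi 0) := by
  intro y₁ hy₁ y₂ hy₂ hy
  have hL := h.error_pos
  rw [mem_Ioi] at hy₁ hy₂
  have hcos := h.strictAntiOn_eval_neg_sq hy₁.le hy₂.le hy
  have hslope := h.mul_eval_neg_sq_lt hy₁ hy
  simp only [b.eval_neg_sq_eq hy₁.le, b.eval_neg_sq_eq hy₂.le] at hcos hslope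
  rw [← b.mul_sin_mul_sinh hy₁.le, ← b.mul_sin_mul_sinh hy₂.le] at hy
  refine lt_of_cos_mul_cosh_lt (b.re_ofReal_mul_I_mem_Ioo h hy₁).2
    (b.re_ofReal_mul_I_mem_Ioo h hy₂).1 (b.im_ofReal_mul_I_pos hy₁).le
    (b.im_ofReal_mul_I_pos hy₂).le (lt_of_mul_lt_mul_left hcos hL.le)
    (le_of_mul_le_mul_left hy.le hL) ?_
  nth_rewrite 1 [← b.mul_sin_mul_sinh hy₁.le] at hslope
  nth_rewrite 3 [← b.mul_sin_mul_sinh hy₂.le] at hslope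
  refine lt_of_mul_lt_mul_left ?_ (mul_pos hL hL).le
  linarith

lemma re_ofReal_mul_I_mem_Icc {y : ℝ} (hy : 0 ≤ y) :
    (φ (y * Complex.I)).re ∈ Icc 0 ((m + 1) * Real.pi) := by
  have hpi : Real.pi ≤ (m + 1) * Real.pi :=
    le_mul_of_one_le_left Real.pi_pos.le (by linarith [Nat.cast_nonneg (α := ℝ) m])
  rcases hy.eq_or_lt with rfl | hy
  · simpa [b.map_zero_re h] using Real.pi_pos.le.trans hpi
  · have hmem := b.re_ofReal_mul_I_mem_Ioo h hy
    exact ⟨hmem.1.le, hmem.2.le.trans hpi⟩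

end IsArccosBranch

/-! ### Univalence -/

lemma isBigO_id_comp_mul {f : ℂ → ℂ} (hf : f =O[Bornology.cobounded ℂ ⊓ 𝓟 openQuadrant] id)
    {c : ℝ} (hc : 0 < c) :
    (fun z => f (c * z)) =O[Bornology.cobounded ℂ ⊓ 𝓟 openQuadrant] id := by
  have hc' : (c : ℂ) ≠ 0 := by exact_mod_cast hc.ne'
  have htendsto : Tendsto (fun z => (c : ℂ) * z) (Bornology.cobounded ℂ ⊓ 𝓟 openQuadrant)
      (Bornology.cobounded ℂ ⊓ 𝓟 openQuadrant) :=
    (tendsto_mul_left_cobounded hc').inf (tendsto_principal_principal.2 fun z hz => by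
      simpa [openQuadrant, hc] using hz)
  exact (hf.comp_tendsto htendsto).trans (Asymptotics.isBigO_const_mul_self _ id _)

lemma hasDerivAt_re_mul {f : ℂ → ℂ} {z : ℂ} {c : ℝ} (hf : DifferentiableAt ℂ f (c * z)) :
    HasDerivAt (fun c : ℝ => (f (c * z)).re) (z * deriv f (c * z)).re c := by
  have hline : HasDerivAt (fun c : ℝ => (c : ℂ) * z) z c := by
    simpa using (Complex.ofRealCLM.hasDerivAt (x := c)).mul_const z
  refine (Complex.reCLM.hasFDerivAt.comp_hasDerivAt c
    (HasDerivAt.comp c hf.hasDerivAt hline)).congr_deriv ?_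
  rw [Complex.reCLM_apply, mul_comm]

lemma re_mul_deriv_pos_of_re_lt_re_mul {f : ℂ → ℂ} (hf : DifferentiableOn ℂ f openQuadrant)
    (hlt : ∀ z ∈ openQuadrant, ∀ c : ℝ, 1 < c → (f z).re < (f (c * z)).re) {z : ℂ}
    (hz : z ∈ openQuadrant) : 0 < (z * deriv f z).re := by
  have hderiv (w : ℂ) (hw : w ∈ openQuadrant) (c : ℝ) (hc : 0 < c) :=
    hasDerivAt_re_mul (z := w) (c := c) (hf.differentiableAt (isOpen_openQuadrant.mem_nhds
      (by simpa [openQuadrant, hc] using hw)))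
  have hnonneg : ∀ w ∈ openQuadrant, 0 ≤ (w * deriv f w).re := by
    intro w hw
    have hd := hderiv w hw 1 one_pos
    rw [Complex.ofReal_one, one_mul] at hd
    refine ge_of_tendsto ((hasDerivAt_iff_tendsto_slope.1 hd).mono_left
      (nhdsWithin_mono (1 : ℝ) fun c (hc : c ∈ Ioi 1) => ne_of_gt hc)) ?_
    filter_upwards [self_mem_nhdsWithin] with c hc
    rw [slope_def_field, Complex.ofReal_one, one_mul]
    exact div_nonneg (sub_nonneg.2 (hlt w hw c hc).le) (sub_nonneg.2 (le_of_lt hc))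
  obtain ⟨c, hc, hslope⟩ := exists_hasDerivAt_eq_slope (fun c : ℝ => (f (c * z)).re) _
    one_lt_two
    (fun c hc => (hderiv z hz c (one_pos.trans_le hc.1)).continuousAt.continuousWithinAt)
    (fun c hc => hderiv z hz c (one_pos.trans hc.1))
  have hc₀ : 0 < c := one_pos.trans hc.1
  have hpos : 0 < ((c * z) * deriv f (c * z)).re := by
    rw [mul_assoc, Complex.re_ofReal_mul, hslope, Complex.ofReal_one, one_mul]
    exact mul_pos hc₀ (div_pos (sub_pos.2 (hlt z hz 2 one_lt_two)) (by norm_num))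
  exact re_pos_of_re_nonneg isOpen_openQuadrant isPreconnected_openQuadrant
    (differentiableOn_id.mul (hf.deriv isOpen_openQuadrant)) hnonneg
    (by simpa [openQuadrant, hc₀] using hz) hpos hz

/-- The Noshiro–Warschawski argument on a single segment. -/
lemma map_ne_map_of_re_deriv_pos {g : ℂ → ℂ} {w₁ w₂ : ℂ} (hne : w₁ ≠ w₂)
    (hc : ContinuousOn g (segment ℝ w₁ w₂))
    (hd : ∀ w ∈ openSegment ℝ w₁ w₂, DifferentiableAt ℂ g w)
    (hpos : ∀ w ∈ openSegment ℝ w₁ w₂, 0 < (deriv g w).re) : g w₁ ≠ g w₂ := by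
  intro heq
  have hδ : w₂ - w₁ ≠ 0 := sub_ne_zero.2 hne.symm
  have hderiv : ∀ t ∈ Ioo (0 : ℝ) 1, HasDerivAt
      (fun t : ℝ => (g (AffineMap.lineMap w₁ w₂ t) / (w₂ - w₁)).re)
      (deriv g (AffineMap.lineMap w₁ w₂ t)).re t := by
    intro t ht
    have hg := (hd _ (lineMap_mem_openSegment ℝ w₁ w₂ ht)).hasDerivAt
    refine (Complex.reCLM.hasFDerivAt.comp_hasDerivAt t ((HasDerivAt.comp t hg
      AffineMap.hasDerivAt_lineMap).div_const (w₂ - w₁))).congr_deriv ?_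
    rw [mul_div_cancel_right₀ _ hδ, Complex.reCLM_apply]
  have hmono : StrictMonoOn (fun t : ℝ => (g (AffineMap.lineMap w₁ w₂ t) / (w₂ - w₁)).re)
      (Icc 0 1) := by
    refine strictMonoOn_of_deriv_pos (convex_Icc _ _) (Complex.continuous_re.comp_continuousOn
      (ContinuousOn.div_const (hc.comp AffineMap.lineMap_continuous.continuousOn
        fun t ht => lineMap_mem_segment ℝ w₁ w₂ ht) _)) fun t ht => ?_
    rw [interior_Icc] at ht
    rw [(hderiv t ht).deriv]
    exact hpos _ (lineMap_mem_openSegment ℝ w₁ w₂ ht)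
  have hlt := hmono ⟨le_rfl, zero_le_one⟩ ⟨zero_le_one, le_rfl⟩ one_pos
  simp [heq] at hlt

lemma exp_mem_openQuadrant {w : ℂ} (hw : w.im ∈ Ioo 0 (Real.pi / 2)) :
    Complex.exp w ∈ openQuadrant := by
  constructor
  · rw [Complex.exp_re]
    exact mul_pos (Real.exp_pos _)
      (Real.cos_pos_of_mem_Ioo ⟨(neg_neg_of_pos Real.pi_div_two_pos).trans hw.1, hw.2⟩)
  · rw [Complex.exp_im]
    exact mul_pos (Real.exp_pos _)
      (Real.sin_pos_of_pos_of_lt_pi hw.1 (hw.2.trans (half_lt_self Real.pi_pos)))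

lemma log_im_mem_Icc {z : ℂ} (hz : z ∈ closedQuadrant) :
    (Complex.log z).im ∈ Icc 0 (Real.pi / 2) := by
  rw [Complex.log_im]
  exact ⟨Complex.arg_nonneg_iff.2 hz.2, Complex.arg_le_pi_div_two_iff.2 (.inl hz.1)⟩

lemma log_im_mem_Ioo {z : ℂ} (hz : z ∈ openQuadrant) :
    (Complex.log z).im ∈ Ioo 0 (Real.pi / 2) := by
  rw [Complex.log_im]
  refine ⟨(Complex.arg_nonneg_iff.2 hz.2.le).lt_of_ne' fun hzero => ?_,
    Complex.arg_lt_pi_div_two_iff.2 (.inl hz.1)⟩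
  exact hz.2.ne' (Complex.arg_eq_zero_iff.1 hzero).2

lemma exp_mem_openQuadrant_of_mem_openSegment_log {z₁ z₂ : ℂ} (h₁ : z₁ ∈ openQuadrant)
    (h₂ : z₂ ∈ closedQuadrant) {w : ℂ}
    (hw : w ∈ openSegment ℝ (Complex.log z₁) (Complex.log z₂)) :
    Complex.exp w ∈ openQuadrant := by
  refine exp_mem_openQuadrant ?_
  rw [← interior_Icc]
  obtain ⟨α, β, hα, hβ, hαβ, rfl⟩ := hw
  have hcombo := (convex_Icc 0 (Real.pi / 2)).combo_interior_self_mem_interior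
    (by rw [interior_Icc]; exact log_im_mem_Ioo h₁) (log_im_mem_Icc h₂) hα hβ.le hαβ
  simpa using hcombo

/-- In the coordinate `w = log z` the hypothesis says `0 < Re (d/dw) f (exp w)`. -/
lemma map_ne_map_of_re_mul_deriv_pos {f : ℂ → ℂ} (hc : ContinuousOn f closedQuadrant)
    (hd : DifferentiableOn ℂ f openQuadrant)
    (hpos : ∀ z ∈ openQuadrant, 0 < (z * deriv f z).re) {z₁ z₂ : ℂ} (h₁ : z₁ ∈ openQuadrant)
    (h₂ : z₂ ∈ closedQuadrant) (h₂₀ : z₂ ≠ 0) (hne : z₁ ≠ z₂) : f z₁ ≠ f z₂ := by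
  have h₁₀ : z₁ ≠ 0 := fun h₀ => by simp [h₀, openQuadrant] at h₁
  have hopen := fun w => exp_mem_openQuadrant_of_mem_openSegment_log (w := w) h₁ h₂
  have hclosed : ∀ w ∈ segment ℝ (Complex.log z₁) (Complex.log z₂),
      Complex.exp w ∈ closedQuadrant := by
    intro w hw
    rw [← insert_endpoints_openSegment] at hw
    rcases hw with rfl | rfl | hw
    · rw [Complex.exp_log h₁₀]
      exact openQuadrant_subset_closedQuadrant h₁
    · rwa [Complex.exp_log h₂₀]
    · exact openQuadrant_subset_closedQuadrant (hopen w hw)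
  have hderiv : ∀ w ∈ openSegment ℝ (Complex.log z₁) (Complex.log z₂),
      HasDerivAt (fun w => f (Complex.exp w)) (deriv f (Complex.exp w) * Complex.exp w) w :=
    fun w hw => (hd.differentiableAt (isOpen_openQuadrant.mem_nhds (hopen w hw))).hasDerivAt.comp w
      (Complex.hasDerivAt_exp w)
  have key := map_ne_map_of_re_deriv_pos (g := fun w => f (Complex.exp w))
    (w₁ := Complex.log z₁) (w₂ := Complex.log z₂)
    (fun heq => hne (by rw [← Complex.exp_log h₁₀, heq, Complex.exp_log h₂₀]))
    (hc.comp Complex.continuous_exp.continuousOn hclosed)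
    (fun w hw => (hderiv w hw).differentiableAt) fun w hw => by
      rw [(hderiv w hw).deriv, mul_comm]
      exact hpos _ (hopen w hw)
  rwa [Complex.exp_log h₁₀, Complex.exp_log h₂₀] at key

namespace IsArccosBranch

variable {m : ℕ} {a L : ℝ} {Q : ℝ[X]} {x : Fin (m + 2) → ℝ} {φ : ℂ → ℂ}

lemma isBigO_id {E : ℝ[X]} (b : IsArccosBranch a L E φ) (hL : L ≠ 0) (hE : 0 < E.degree) :
    φ =O[Bornology.cobounded ℂ ⊓ 𝓟 openQuadrant] id := by
  have hL' : (L : ℂ) ≠ 0 := by exact_mod_cast hL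
  refine isBigO_id_of_cos_eq (R := C (L : ℂ)⁻¹ * E.map (algebraMap ℝ ℂ)) ?_ b.differentiableOn
    fun z hz => ?_
  · rwa [degree_C_mul (inv_ne_zero hL'), degree_map]
  · rw [eval_mul, eval_C, eval_map_algebraMap,
      b.aeval_eq z (openQuadrant_subset_closedQuadrant hz), inv_mul_cancel_left₀ hL']

variable (b : IsArccosBranch a L (evenError Q) φ) (h : Equioscillates m a L Q x)
include b h

lemma mapsTo_halfStrip : MapsTo φ openQuadrant (halfStrip ((m + 1) * Real.pi)) := by
  have hgrowth := b.isBigO_id h.error_pos.ne' (degree_evenError_pos Q)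
  have hWpos : (0 : ℝ) < (m + 1) * Real.pi := by positivity
  have hW : (φ (1 : ℝ)).re = (m + 1) * Real.pi := b.re_eq_right h le_rfl
  have hleft : ∀ z ∈ openQuadrant, 0 < (φ z).re := fun z hz =>
    re_pos_of_re_nonneg_on_axes b.differentiableOn b.continuousOn hgrowth
      (fun t ht => (b.re_ofReal_mem_Icc h ht).1) (fun y hy => (b.re_ofReal_mul_I_mem_Icc h hy).1)
      (ofReal_mem_closedQuadrant zero_le_one) (hW.symm ▸ hWpos) hz
  have hright : ∀ z ∈ openQuadrant, 0 < ((((m + 1) * Real.pi : ℝ) : ℂ) - φ z).re := fun z hz =>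
    re_pos_of_re_nonneg_on_axes (f := fun z => (((m + 1) * Real.pi : ℝ) : ℂ) - φ z)
      (b.differentiableOn.const_sub _) (continuousOn_const.sub b.continuousOn)
      (((Asymptotics.isLittleO_const_id_cobounded _).isBigO.mono inf_le_left).sub hgrowth)
      (fun t ht => by simpa using (b.re_ofReal_mem_Icc h ht).2)
      (fun y hy => by simpa using (b.re_ofReal_mul_I_mem_Icc h hy).2)
      (ofReal_mem_closedQuadrant le_rfl) (by simpa [b.map_zero_re h] using hWpos) hz
  exact fun z hz => ⟨hleft z hz, by simpa using hright z hz, b.im_pos z hz⟩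

lemma re_lt_re_mul {c : ℝ} (hc : 1 < c) {z : ℂ} (hz : z ∈ openQuadrant) :
    (φ z).re < (φ (c * z)).re := by
  have hc₀ : 0 < c := one_pos.trans hc
  have hgrowth := b.isBigO_id h.error_pos.ne' (degree_evenError_pos Q)
  have himag : ∀ y : ℝ, 0 < y → 0 < (φ (c * (y * Complex.I)) - φ (y * Complex.I)).re := by
    intro y hy
    rw [Complex.sub_re, sub_pos, ← mul_assoc, ← Complex.ofReal_mul]
    exact b.strictMonoOn_re_ofReal_mul_I h hy (mul_pos hc₀ hy) (lt_mul_of_one_lt_left hy hc)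
  have key := re_pos_of_re_nonneg_on_axes (f := fun z => φ (c * z) - φ z)
    ((b.differentiableOn.comp (differentiableOn_id.const_mul _) fun z hz => by
      simpa [openQuadrant, hc₀] using hz).sub b.differentiableOn)
    ((b.continuousOn.comp (continuousOn_const.mul continuousOn_id) fun z hz => by
      simpa [closedQuadrant, hc₀] using hz).sub b.continuousOn)
    ((isBigO_id_comp_mul hgrowth hc₀).sub hgrowth)
    (fun t ht => by
      rw [Complex.sub_re, sub_nonneg, ← Complex.ofReal_mul]
      exact b.monotoneOn_re_ofReal h ht (mul_nonneg hc₀.le ht) (le_mul_of_one_le_left ht hc.le))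
    (fun y hy => by
      rcases hy.eq_or_lt with rfl | hy
      · simp
      · exact (himag y hy).le)
    (ofReal_mul_I_mem_closedQuadrant zero_le_one) (himag 1 one_pos) hz
  simpa using key

lemma map_ne_map {z₁ z₂ : ℂ} (h₁ : z₁ ∈ openQuadrant) (h₂ : z₂ ∈ closedQuadrant)
    (hne : z₁ ≠ z₂) : φ z₁ ≠ φ z₂ := by
  rcases eq_or_ne z₂ 0 with rfl | h₂₀
  · intro heq
    exact (b.mapsTo_halfStrip h h₁).1.ne' (heq ▸ b.map_zero_re h)
  · refine map_ne_map_of_re_mul_deriv_pos b.continuousOn b.differentiableOn (fun z hz => ?_)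
      h₁ h₂ h₂₀ hne
    exact re_mul_deriv_pos_of_re_lt_re_mul b.differentiableOn
      (fun z hz c hc => b.re_lt_re_mul h hc hz) hz

end IsArccosBranch

/-! ### The image of the quadrant -/

lemma norm_cos_le_exp_norm (w : ℂ) : ‖Complex.cos w‖ ≤ Real.exp ‖w‖ := by
  have hpos : ‖Complex.exp (w * Complex.I)‖ ≤ Real.exp ‖w‖ := by
    simpa using Complex.norm_exp_le_exp_norm (w * Complex.I)
  have hneg : ‖Complex.exp (-w * Complex.I)‖ ≤ Real.exp ‖w‖ := by
    simpa using Complex.norm_exp_le_exp_norm (-w * Complex.I)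
  rw [Complex.cos, norm_div, Complex.norm_ofNat]
  linarith [norm_add_le (Complex.exp (w * Complex.I)) (Complex.exp (-w * Complex.I))]

lemma tendsto_norm_aeval_cobounded {p : ℝ[X]} (hp : 0 < p.degree) :
    Tendsto (fun z : ℂ => ‖aeval z p‖) (Bornology.cobounded ℂ) atTop := by
  simp only [← eval_map_algebraMap]
  exact Polynomial.tendsto_norm_atTop _ (by rwa [degree_map]) tendsto_norm_cobounded_atTop

lemma isClosed_image_of_tendsto_cobounded {X Y : Type*} [PseudoMetricSpace X] [ProperSpace X]
    [MetricSpace Y] [ProperSpace Y] {f : X → Y} {s : Set X} (hs : IsClosed s)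
    (hf : ContinuousOn f s)
    (hlim : Tendsto f (Bornology.cobounded X ⊓ 𝓟 s) (Bornology.cobounded Y)) :
    IsClosed (f '' s) := by
  have hcocompact : Tendsto (s.domRestrict f) (cocompact s) (cocompact Y) := by
    rw [← Metric.cobounded_eq_cocompact (α := Y)]
    refine hlim.comp (tendsto_inf.2 ⟨?_, tendsto_principal.2 (.of_forall fun z => z.2)⟩)
    rw [Metric.cobounded_eq_cocompact]
    exact hs.isClosedEmbedding_subtypeVal.tendsto_cocompact
  have hproper : IsProperMap (s.domRestrict f) :=
    isProperMap_iff_tendsto_cocompact.2 ⟨hf.domRestrict, hcocompact⟩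
  have hclosed := hproper.isClosedMap.isClosed_range
  rwa [Set.range_domRestrict] at hclosed

lemma eq_connectedComponentIn_of_disjoint_frontier {X : Type*} [TopologicalSpace X]
    {s t : Set X} {c : X} (hs : IsOpen s) (hconn : IsPreconnected s) (hc : c ∈ s) (hst : s ⊆ t)
    (hfrontier : Disjoint (frontier s) t) : s = connectedComponentIn t c := by
  refine subset_antisymm (hconn.subset_connectedComponentIn hc hst) ?_
  refine isPreconnected_connectedComponentIn.subset_of_closure_inter_subset hs
    ⟨c, mem_connectedComponentIn (hst hc), hc⟩ fun w ⟨hwc, hwt⟩ => ?_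
  by_contra hws
  refine hfrontier.notMem_of_mem_left ?_ (connectedComponentIn_subset _ _ hwt)
  rw [hs.frontier_eq]
  exact ⟨hwc, hws⟩

lemma closedQuadrant_sdiff_openQuadrant : closedQuadrant \ openQuadrant =
    (fun t : ℝ => (t : ℂ)) '' Ici 0 ∪ (fun y : ℝ => (y : ℂ) * Complex.I) '' Ioi 0 := by
  apply subset_antisymm
  · rintro z ⟨hz, hz'⟩
    rcases hz.2.eq_or_lt with him | him
    · exact .inl ⟨z.re, hz.1, Complex.ext (by simp) (by simpa using him)⟩
    · have hre : z.re = 0 := le_antisymm (not_lt.1 fun hre => hz' ⟨hre, him⟩) hz.1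
      exact .inr ⟨z.im, him, Complex.ext (by simp [hre]) (by simp)⟩
  · rintro _ (⟨t, ht, rfl⟩ | ⟨y, hy, rfl⟩)
    · exact ⟨ofReal_mem_closedQuadrant ht, by simp [openQuadrant]⟩
    · exact ⟨ofReal_mul_I_mem_closedQuadrant (le_of_lt hy), by simp [openQuadrant]⟩

lemma tendsto_ofReal_cobounded_inf_closedQuadrant :
    Tendsto (fun t : ℝ => (t : ℂ)) atTop (Bornology.cobounded ℂ ⊓ 𝓟 closedQuadrant) := by
  refine tendsto_inf.2 ⟨?_, tendsto_principal.2 ?_⟩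
  · rw [← tendsto_norm_atTop_iff_cobounded]
    simpa using tendsto_abs_atTop_atTop
  · exact (eventually_ge_atTop 0).mono fun t => ofReal_mem_closedQuadrant

lemma tendsto_ofReal_mul_I_cobounded_inf_closedQuadrant :
    Tendsto (fun y : ℝ => (y : ℂ) * Complex.I) atTop
      (Bornology.cobounded ℂ ⊓ 𝓟 closedQuadrant) := by
  refine tendsto_inf.2 ⟨?_, tendsto_principal.2 ?_⟩
  · rw [← tendsto_norm_atTop_iff_cobounded]
    simpa using tendsto_abs_atTop_atTop
  · exact (eventually_ge_atTop 0).mono fun y => ofReal_mul_I_mem_closedQuadrant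

namespace IsArccosBranch

variable {m : ℕ} {a L : ℝ} {Q : ℝ[X]} {x : Fin (m + 2) → ℝ} {φ : ℂ → ℂ}

lemma tendsto_cobounded {E : ℝ[X]} (b : IsArccosBranch a L E φ) (hL : 0 < L) (hE : 0 < E.degree) :
    Tendsto φ (Bornology.cobounded ℂ ⊓ 𝓟 closedQuadrant) (Bornology.cobounded ℂ) := by
  rw [← tendsto_norm_atTop_iff_cobounded]
  have hlim := (tendsto_norm_aeval_cobounded hE).mono_left
    (inf_le_left (b := 𝓟 closedQuadrant))
  refine tendsto_atTop_mono' _ ?_ (Real.tendsto_log_atTop.comp (hlim.atTop_div_const hL))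
  filter_upwards [hlim.eventually_gt_atTop 0,
    mem_inf_of_right (mem_principal_self closedQuadrant)] with z hz₀ hz
  rw [Function.comp_apply, Real.log_le_iff_le_exp (div_pos hz₀ hL), div_le_iff₀' hL,
    b.aeval_eq z hz, norm_mul, Complex.norm_of_nonneg hL.le]
  exact mul_le_mul_of_nonneg_left (norm_cos_le_exp_norm _) hL.le

variable (b : IsArccosBranch a L (evenError Q) φ) (h : Equioscillates m a L Q x)
include b h

lemma re_mem_Icc {z : ℂ} (hz : z ∈ closedQuadrant) : (φ z).re ∈ Icc 0 ((m + 1) * Real.pi) := by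
  have hmaps : MapsTo (fun w => (φ w).re) (closure openQuadrant)
      (closure (Icc 0 ((m + 1) * Real.pi))) :=
    MapsTo.closure_of_continuousOn
      (fun w hw => ⟨(b.mapsTo_halfStrip h hw).1.le, (b.mapsTo_halfStrip h hw).2.1.le⟩) (by
        rw [closure_openQuadrant]
        exact Complex.continuous_re.comp_continuousOn b.continuousOn)
  rw [closure_openQuadrant, closure_Icc] at hmaps
  exact hmaps hz

lemma tendsto_im :
    Tendsto (fun z => (φ z).im) (Bornology.cobounded ℂ ⊓ 𝓟 closedQuadrant) atTop := by
  have hnorm := tendsto_norm_atTop_iff_cobounded.2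
    (b.tendsto_cobounded h.error_pos (degree_evenError_pos Q))
  refine tendsto_atTop_mono' _ ?_ (tendsto_atTop_add_const_right _ (-((m + 1) * Real.pi)) hnorm)
  filter_upwards [mem_inf_of_right (mem_principal_self closedQuadrant)] with z hz
  have hle := Complex.norm_le_abs_re_add_abs_im (φ z)
  rw [abs_of_nonneg (b.re_mem_Icc h hz).1, abs_of_nonneg (b.im_nonneg hz)] at hle
  linarith [(b.re_mem_Icc h hz).2]

lemma isOpen_image : IsOpen (φ '' openQuadrant) := by
  have hφ : AnalyticOnNhd ℂ φ openQuadrant := b.differentiableOn.analyticOnNhd isOpen_openQuadrant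
  rcases hφ.is_constant_or_isOpen isPreconnected_openQuadrant with ⟨c, hc⟩ | hopen
  · have h₁ := one_add_I_mem_openQuadrant
    have h₂ : 2 + Complex.I ∈ openQuadrant := by simp [openQuadrant]
    exact absurd ((hc _ h₁).trans (hc _ h₂).symm)
      (b.map_ne_map h h₁ (openQuadrant_subset_closedQuadrant h₂) (by simp))
  · exact hopen _ subset_rfl isOpen_openQuadrant

lemma closure_image : closure (φ '' openQuadrant) = φ '' closedQuadrant := by
  refine subset_antisymm (closure_minimal (image_mono openQuadrant_subset_closedQuadrant) ?_) ?_
  · exact isClosed_image_of_tendsto_cobounded isClosed_closedQuadrant b.continuousOn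
      (b.tendsto_cobounded h.error_pos (degree_evenError_pos Q))
  · have hcont := b.continuousOn
    rw [← closure_openQuadrant] at hcont ⊢
    exact hcont.image_closure

lemma frontier_image_eq_image :
    frontier (φ '' openQuadrant) = φ '' (closedQuadrant \ openQuadrant) := by
  rw [(b.isOpen_image h).frontier_eq, b.closure_image h]
  apply subset_antisymm
  · rintro _ ⟨⟨z, hz, rfl⟩, hnot⟩
    exact ⟨z, ⟨hz, fun hz' => hnot (mem_image_of_mem φ hz')⟩, rfl⟩
  · rintro _ ⟨z, ⟨hz, hz'⟩, rfl⟩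
    refine ⟨mem_image_of_mem φ hz, ?_⟩
    rintro ⟨w, hw, heq⟩
    exact b.map_ne_map h hw hz (ne_of_mem_of_not_mem hw hz') heq

lemma antitoneOn_im_left : AntitoneOn (fun t : ℝ => (φ t).im) (Icc 0 a) := by
  intro s hs t ht hst
  have ha : a ≤ x 1 := (h.node_mem 1).1
  have hle := h.strictAntiOn_left.antitoneOn ⟨hs.1, hs.2.trans ha⟩ ⟨ht.1, ht.2.trans ha⟩ hst
  rw [b.eval_eq hs.1, b.eval_eq ht.1, b.re_eq_zero_left h hs, b.re_eq_zero_left h ht,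
    Real.cos_zero, one_mul, one_mul] at hle
  have habs := Real.cosh_le_cosh.1 (le_of_mul_le_mul_left hle h.error_pos)
  rwa [abs_of_nonneg (b.im_nonneg (ofReal_mem_closedQuadrant hs.1)),
    abs_of_nonneg (b.im_nonneg (ofReal_mem_closedQuadrant ht.1))] at habs

lemma image_ofReal_Icc_left :
    (fun t : ℝ => φ t) '' Icc 0 a = (fun t : ℝ => (t : ℂ) * Complex.I) '' Icc 0 (φ 0).im := by
  have him : (fun t : ℝ => (φ t).im) '' Icc 0 a = Icc 0 (φ 0).im := by
    rw [ContinuousOn.image_Icc_of_antitoneOn h.pos.le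
      (b.continuousOn_im_ofReal.mono Icc_subset_Ici_self) (b.antitoneOn_im_left h), b.map_a]
    simp
  rw [← him, image_image]
  refine image_congr fun t ht => ?_
  exact Complex.ext (by simp [b.re_eq_zero_left h ht]) (by simp)

lemma map_one : φ (1 : ℝ) = ((m + 1) * Real.pi : ℝ) :=
  Complex.ext (b.re_eq_right h le_rfl) (b.im_eq_zero_of_abs_le h.error_pos zero_le_one
    (h.abs_le 1 ⟨h.lt_one.le, le_rfl⟩))

lemma image_ofReal_Icc_middle :
    (fun t : ℝ => φ t) '' Icc a 1 = (fun t : ℝ => (t : ℂ)) '' Icc 0 ((m + 1) * Real.pi) := by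
  have hsub : Icc a 1 ⊆ Ici 0 := fun t ht => h.pos.le.trans ht.1
  have hre : (fun t : ℝ => (φ t).re) '' Icc a 1 = Icc 0 ((m + 1) * Real.pi) := by
    rw [ContinuousOn.image_Icc_of_monotoneOn h.lt_one.le (b.continuousOn_re_ofReal.mono hsub)
      ((b.monotoneOn_re_ofReal h).mono hsub), b.map_a, b.map_one h, Complex.ofReal_re,
      Complex.zero_re]
  rw [← hre, image_image]
  refine image_congr fun t ht => ?_
  exact Complex.ext (by simp) (by
    simp [b.im_eq_zero_of_abs_le h.error_pos (hsub ht) (h.abs_le t ht)])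

lemma image_ofReal_Ici_right : (fun t : ℝ => φ t) '' Ici 1 =
    (fun t : ℝ => (((m + 1) * Real.pi : ℝ) : ℂ) + t * Complex.I) '' Ici 0 := by
  have hsub : Ici 1 ⊆ Ici (0 : ℝ) := Ici_subset_Ici.2 zero_le_one
  have him : (fun t : ℝ => (φ t).im) '' Ici 1 = Ici 0 := by
    refine subset_antisymm ?_ ?_
    · rintro _ ⟨t, ht, rfl⟩
      exact b.im_nonneg (ofReal_mem_closedQuadrant (hsub ht))
    · have hivt := intermediate_value_Ici (b.continuousOn_im_ofReal.mono hsub)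
        ((b.tendsto_im h).comp tendsto_ofReal_cobounded_inf_closedQuadrant)
      rwa [b.map_one h, Complex.ofReal_im] at hivt
  rw [← him, image_image]
  refine image_congr fun t ht => ?_
  rw [← b.re_eq_right h ht, Complex.re_add_im]

lemma frontier_image : frontier (φ '' openQuadrant) =
    (fun y : ℝ => φ (y * Complex.I)) '' Ioi 0
      ∪ (fun t : ℝ => (t : ℂ) * Complex.I) '' Icc 0 (φ 0).im
      ∪ (fun t : ℝ => (t : ℂ)) '' Icc 0 ((m + 1) * Real.pi)
      ∪ (fun t : ℝ => (((m + 1) * Real.pi : ℝ) : ℂ) + (t : ℂ) * Complex.I) '' Ici 0 := by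
  rw [← b.image_ofReal_Icc_left h, ← b.image_ofReal_Icc_middle h, ← b.image_ofReal_Ici_right h,
    b.frontier_image_eq_image h, closedQuadrant_sdiff_openQuadrant, image_union, image_image,
    image_image, ← Icc_union_Ici_eq_Ici zero_le_one, ← Icc_union_Icc_eq_Icc h.pos.le h.lt_one.le,
    image_union, image_union]
  ac_rfl

lemma tendsto_ofReal_mul_I_nhdsGT_zero :
    Tendsto (fun y : ℝ => φ (y * Complex.I)) (𝓝[>] 0) (𝓝 ((φ 0).im * Complex.I)) := by
  have hlim := (b.continuousOn_ofReal_mul_I 0 self_mem_Ici).tendsto.mono_left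
    (nhdsWithin_mono _ Ioi_subset_Ici_self)
  have hzero : φ 0 = (φ 0).im * Complex.I := Complex.ext (by simp [b.map_zero_re h]) (by simp)
  rwa [Complex.ofReal_zero, zero_mul, hzero] at hlim

lemma isCrosscut :
    IsCrosscut ((m + 1) * Real.pi) (fun y : ℝ => φ (y * Complex.I)) (φ 0).im where
  continuousOn := b.continuousOn_ofReal_mul_I.mono Ioi_subset_Ici_self
  injOn y₁ hy₁ y₂ hy₂ heq := (b.strictMonoOn_re_ofReal_mul_I h).injOn hy₁ hy₂
    (congrArg Complex.re heq)
  mapsTo y hy :=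
    ⟨(b.re_ofReal_mul_I_mem_Ioo h hy).1, (b.re_ofReal_mul_I_mem_Ioo h hy).2.trans_le
      (le_mul_of_one_le_left Real.pi_pos.le (by linarith [Nat.cast_nonneg (α := ℝ) m])),
      b.im_ofReal_mul_I_pos hy⟩
  start_pos := b.map_zero_im_pos h
  tendsto_start := b.tendsto_ofReal_mul_I_nhdsGT_zero h
  tendsto_end := (b.tendsto_im h).comp tendsto_ofReal_mul_I_cobounded_inf_closedQuadrant

lemma disjoint_frontier_image : Disjoint (frontier (φ '' openQuadrant))
    (halfStrip ((m + 1) * Real.pi) \ (fun y : ℝ => φ (y * Complex.I)) '' Ioi 0) := by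
  rw [b.frontier_image h, disjoint_left]
  rintro _ (((hγ | ⟨t, -, rfl⟩) | ⟨t, -, rfl⟩) | ⟨t, -, rfl⟩) ⟨hstrip, hcut⟩
  · exact hcut hγ
  · simpa using hstrip.1
  · simpa using hstrip.2.2
  · simpa using hstrip.2.1

lemma isRegionBoundedOnLeft :
    IsRegionBoundedOnLeft ((m + 1) * Real.pi) (fun y : ℝ => φ (y * Complex.I)) (φ 0).im
      (φ '' openQuadrant) where
  frontier_eq := b.frontier_image h
  component := by
    have hsub : φ '' openQuadrant ⊆
        halfStrip ((m + 1) * Real.pi) \ (fun y : ℝ => φ (y * Complex.I)) '' Ioi 0 := by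
      rw [subset_sdiff]
      refine ⟨(b.mapsTo_halfStrip h).image_subset, ?_⟩
      refine (disjoint_frontier_iff_isOpen.2 (b.isOpen_image h)).symm.mono_right ?_
      rw [b.frontier_image h]
      exact subset_union_left.trans (subset_union_left.trans subset_union_left)
    have hc := mem_image_of_mem φ one_add_I_mem_openQuadrant
    exact ⟨_, hsub hc, eq_connectedComponentIn_of_disjoint_frontier (b.isOpen_image h)
      (isPreconnected_openQuadrant.image φ (b.continuousOn.mono openQuadrant_subset_closedQuadrant))
      hc hsub (b.disjoint_frontier_image h)⟩

lemma isNormalizedConformalMap :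
    IsNormalizedConformalMap a ((m + 1) * Real.pi) φ (φ '' openQuadrant) where
  differentiableOn := b.differentiableOn
  injOn z₁ h₁ z₂ h₂ heq := by
    by_contra hne
    exact b.map_ne_map h h₁ (openQuadrant_subset_closedQuadrant h₂) hne heq
  image_eq := rfl
  continuousOn := b.continuousOn
  map_a := b.map_a
  map_one := by exact_mod_cast b.map_one h
  map_infty := b.tendsto_cobounded h.error_pos (degree_evenError_pos Q)

end IsArccosBranch

theorem mainTheorem5 (m : ℕ) (hm : 1 ≤ m) (a : ℝ) (ha0 : 0 < a) (ha1 : a < 1) :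
    (∃! P : ℝ[X], IsBestApprox m a P) ∧
    ∀ P : ℝ[X], IsBestApprox m a P →
      ∃ (γ : ℝ → ℂ) (v₀ : ℝ) (G : Set ℂ) (φ : ℂ → ℂ),
        IsCrosscut (((m : ℝ) + 1) * Real.pi) γ v₀ ∧
        IsRegionBoundedOnLeft (((m : ℝ) + 1) * Real.pi) γ v₀ G ∧
        IsNormalizedConformalMap a (((m : ℝ) + 1) * Real.pi) φ G ∧
        (∀ z ∈ closedQuadrant,
          aeval z P = z + (approxError m a : ℂ) * Complex.cos (φ z)) ∧
        (∀ y : ℝ, 0 < y → φ ((y : ℂ) * Complex.I) = γ y) ∧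
        (∀ y : ℝ, 0 < y →
          approxError m a * Real.sin (γ y).re * Real.sinh (γ y).im = y) := by
  obtain ⟨L, Q, hL, hQ⟩ := exists_isBestEvenApprox m ha1
  obtain ⟨x, h⟩ := hQ.exists_equioscillates hm ha0 ha1 hL
  refine ⟨⟨Q.comp (X ^ 2), h.isBestApprox_iff.2 rfl, fun P => h.isBestApprox_iff.1⟩, fun P hP => ?_⟩
  obtain rfl := h.isBestApprox_iff.1 hP
  obtain ⟨φ, b⟩ := exists_isArccosBranch ha0.le hL (fun z hz w hw => h.aeval_evenError_ne hw hz)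
    h.eval_left_endpoint
  refine ⟨fun y => φ (y * Complex.I), (φ 0).im, φ '' openQuadrant, φ, b.isCrosscut h,
    b.isRegionBoundedOnLeft h, b.isNormalizedConformalMap h, fun z hz => ?_, fun y _ => rfl,
    fun y hy => ?_⟩
  · rw [h.approxError_eq, ← b.aeval_eq z hz, evenError, map_sub, aeval_X, add_sub_cancel]
  · rw [h.approxError_eq, mul_assoc, b.mul_sin_mul_sinh hy.le]
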